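/- Let $k$ be a finite field with $q$ elements, let $K$ be a finite extension of the rational function field $k(t)$, and let $R$ be the integral closure of $k[t]$ in $K$. Let $E$ be a model over $R$ of a Drinfeld module of rank $n\ge 0$: the additive group $\mathbb{G}_{a,R}$ with the action of $k[t]$ given by a $k$-algebra homomorphism $$\varphi\colon k[t]\to \mathrm{End}(\mathbb{G}_{a,R}),\qquad t\mapsto t+a_1\tau+\cdots+a_n\tau^n,\qquad a_i\in R,\ a_n\neq 0,$$ where $\tau$ is the $q$-th power Frobenius (for $n=0$ this is $t\mapsto t$). For an $R$-algebra $B$ let $E(B)$ be the additive group of $B$ with the $k[t]$-module structure given by $\varphi$, and let $\mathrm{Lie}_E(B)=B$ with its usual $k[t]$-module structure. Let $k((t^{-1}))^{\mathrm{sep}}$ be a separable closure of $k((t^{-1}))$ with Galois group $G$, and put $K_\infty=K\otimes_{k(t)}k((t^{-1}))$ and $K_\infty^{\mathrm{sep}}=K\otimes_{k(t)}k((t^{-1}))^{\mathrm{sep}}$. Let $\exp_E(X)=\sum_{i\ge 0}e_iX^{q^i}\in K[[X]]$ be the unique power series of this form with $e_0=1$ and $\varphi(t)(\exp_E(X))=\exp_E(tX)$.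 It converges on all of $K_\infty$ and $K_\infty^{\mathrm{sep}}$, and $\exp_E\colon \mathrm{Lie}_E(K_\infty^{\mathrm{sep}})\to E(K_\infty^{\mathrm{sep}})$ is surjective; let $\Lambda_E$ be its kernel, a discrete $G$-module, and let $\delta\colon E(K_\infty)\to \mathrm{H}^1(G,\Lambda_E)$ be the connecting homomorphism of the short exact sequence $0\to\Lambda_E\to \mathrm{Lie}_E(K_\infty^{\mathrm{sep}})\to E(K_\infty^{\mathrm{sep}})\to 0$ in continuous cohomology, so that $\delta(y)$ is the class of $g\mapsto gx-x$ for any $x$ with $\exp_E(x)=y$. Then the cokernel of the composite $E(R)\to E(K_\infty)\xrightarrow{\ \delta\ }\mathrm{H}^1(G,\Lambda_E)$ is finite. Moreover, the inverse image $\exp_E^{-1}(E(R))\subset \mathrm{Lie}_E(K_\infty)$ of $E(R)\subset E(K_\infty)$ is a discrete and co-compact sub-$k[t]$-module of $\mathrm{Lie}_E(K_\infty)$. -/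

import Mathlib

open scoped Polynomial TensorProduct

set_option linter.unusedSectionVars false

noncomputable section

namespace DrinfeldUnits

/-! ### The local field at infinity and the rings `K ⊗ L` -/

open scoped Classical in
/-- The field `k((t⁻¹))`: the completion of `k(t)` at the place `t = ∞`. -/
abbrev LocalInfty (k : Type*) [Field k] : Type _ := RatFunc.CompletionAtInfty k

/-- The `k`-algebra `K ⊗_{k(t)} L` (written with the factor `L` on the left), for an extension
`L` of `k(t)`. The ring `K_∞` is the case `L = k((t⁻¹))`, the ring `K_∞^sep` the case of a
separable closure `L` of `k((t⁻¹))`. -/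
def Ext (k K L : Type*) [Field k] [Field K] [Field L] [Algebra (RatFunc k) K]
    [Algebra (RatFunc k) L] : Type _ := L ⊗[RatFunc k] K

/-- `K_∞ = K ⊗_{k(t)} k((t⁻¹))`. -/
abbrev KInfty (k K : Type*) [Field k] [Field K] [Algebra (RatFunc k) K] : Type _ :=
  Ext k K (LocalInfty k)

section Ext

variable (k K L : Type*) [Field k] [Field K] [Field L] [Algebra (RatFunc k) K]
  [Algebra (RatFunc k) L]

instance : CommRing (Ext k K L) := inferInstanceAs (CommRing (L ⊗[RatFunc k] K))

/-- The `K`-algebra structure `x ↦ 1 ⊗ x`. -/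
instance : Algebra K (Ext k K L) :=
  (Algebra.TensorProduct.includeRight (R := RatFunc k) (A := L) (B := K)).toRingHom.toAlgebra

/-- The `k[t]`-algebra structure is the one induced by `k[t] → K`. -/
instance [Algebra k[X] K] : Algebra k[X] (Ext k K L) :=
  ((algebraMap K (Ext k K L)).comp (algebraMap k[X] K)).toAlgebra

instance [Algebra k[X] K] : IsScalarTower k[X] K (Ext k K L) :=
  IsScalarTower.of_algebraMap_eq fun _ => rfl

variable [Algebra (LocalInfty k) L] [IsScalarTower (RatFunc k) (LocalInfty k) L]

/-- The `k((t⁻¹))`-algebra structure `c ↦ c ⊗ 1`. -/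
instance : Algebra (LocalInfty k) (Ext k K L) :=
  inferInstanceAs (Algebra (LocalInfty k) (L ⊗[RatFunc k] K))

/-- The topology of `K ⊗ L` is the finest one which makes it a topological vector space over
`k((t⁻¹))`. It induces on each finite-dimensional `k((t⁻¹))`-subspace its canonical topology; in
particular the topology of `K_∞` is its usual one (that of a finite product of local fields). -/
instance : TopologicalSpace (Ext k K L) := moduleTopology (LocalInfty k) (Ext k K L)

instance : IsModuleTopology (LocalInfty k) (Ext k K L) := ⟨rfl⟩

instance : ContinuousAdd (Ext k K L) := IsModuleTopology.toContinuousAdd (LocalInfty k) _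

instance : ContinuousSMul (LocalInfty k) (Ext k K L) :=
  IsModuleTopology.toContinuousSMul (LocalInfty k) _

end Ext

section Galois

variable (k K Ω : Type*) [Field k] [Field K] [Field Ω] [Algebra (RatFunc k) K]
  [Algebra (RatFunc k) Ω] [Algebra (LocalInfty k) Ω] [IsScalarTower (RatFunc k) (LocalInfty k) Ω]

/-- The natural map `K ⊗ k((t⁻¹)) → K ⊗ Ω`. -/
def toSep : KInfty k K →+* Ext k K Ω :=
  (Algebra.TensorProduct.map (IsScalarTower.toAlgHom (RatFunc k) (LocalInfty k) Ω)
    (AlgHom.id (RatFunc k) K)).toRingHom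

/-- The map `g ⊗ id` on `Ω ⊗ K`. -/
def galMap (g : Gal(Ω/LocalInfty k)) : Ext k K Ω →ₐ[LocalInfty k] Ext k K Ω :=
  (Algebra.TensorProduct.map (g : Ω →ₐ[LocalInfty k] Ω) (AlgHom.id (RatFunc k) K) :
    Ω ⊗[RatFunc k] K →ₐ[LocalInfty k] Ω ⊗[RatFunc k] K)

variable {k K Ω}

lemma galMap_one (x : Ext k K Ω) : galMap k K Ω 1 x = x := by
  refine TensorProduct.induction_on x (map_zero _) (fun a b => rfl) fun a b ha hb => ?_
  exact (map_add (galMap k K Ω 1) a b).trans (congrArg₂ _ ha hb)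

lemma galMap_mul (g h : Gal(Ω/LocalInfty k)) (x : Ext k K Ω) :
    galMap k K Ω (g * h) x = galMap k K Ω g (galMap k K Ω h x) := by
  refine TensorProduct.induction_on x ?_ (fun a b => rfl) fun a b ha hb => ?_
  · have h1 : galMap k K Ω h 0 = 0 := map_zero _
    exact (map_zero (galMap k K Ω (g * h))).trans
      ((map_zero (galMap k K Ω g)).symm.trans (congrArg _ h1.symm))
  · have h1 := map_add (galMap k K Ω (g * h)) a b
    have h2 := map_add (galMap k K Ω h) a b
    have h3 := map_add (galMap k K Ω g) (galMap k K Ω h a) (galMap k K Ω h b)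
    exact h1.trans ((congrArg₂ _ ha hb).trans (h3.symm.trans (congrArg _ h2.symm)))

/-- The Galois group acts on `Ω ⊗ K` through the factor `Ω`. -/
instance : MulSemiringAction Gal(Ω/LocalInfty k) (Ext k K Ω) where
  smul g x := galMap k K Ω g x
  one_smul := galMap_one
  mul_smul := galMap_mul
  smul_zero g := map_zero (galMap k K Ω g)
  smul_add g := map_add (galMap k K Ω g)
  smul_one g := map_one (galMap k K Ω g)
  smul_mul g := map_mul (galMap k K Ω g)

lemma smul_def (g : Gal(Ω/LocalInfty k)) (x : Ext k K Ω) : g • x = galMap k K Ω g x := rfl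

lemma smul_algebraMap (g : Gal(Ω/LocalInfty k)) (a : K) :
    g • algebraMap K (Ext k K Ω) a = algebraMap K (Ext k K Ω) a := by
  change Algebra.TensorProduct.map (g : Ω →ₐ[LocalInfty k] Ω) (AlgHom.id (RatFunc k) K)
    ((1 : Ω) ⊗ₜ[RatFunc k] a) = (1 : Ω) ⊗ₜ[RatFunc k] a
  simp

instance [Algebra k[X] K] : SMulCommClass Gal(Ω/LocalInfty k) k[X] (Ext k K Ω) where
  smul_comm g p x := by
    rw [Algebra.smul_def, Algebra.smul_def, smul_mul',
      IsScalarTower.algebraMap_apply k[X] K (Ext k K Ω), smul_algebraMap]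

end Galois

/-! ### The first cohomology group of a discrete module over a topological group -/

section Cohomology

variable (A G M : Type*) [CommRing A] [Group G] [TopologicalSpace G] [AddCommGroup M]
  [Module A M] [DistribMulAction G M] [SMulCommClass G A M]

/-- Continuous 1-cocycles of `G` with values in the discrete module `M` (a map to a discrete
space is continuous if and only if it is locally constant). -/
def Z1 : Submodule A (G → M) where
  carrier := {f | IsLocallyConstant f ∧ ∀ g h, f (g * h) = f g + g • f h}
  zero_mem' := ⟨IsLocallyConstant.const 0, fun g h => by simp⟩
  add_mem' {a b} ha hb := ⟨ha.1.add hb.1, fun g h => by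
    simp only [Pi.add_apply, ha.2, hb.2, smul_add]; abel⟩
  smul_mem' c a ha := ⟨ha.1.comp (c • ·), fun g h => by
    simp only [Pi.smul_apply, ha.2, smul_add, smul_comm g c]⟩

/-- 1-coboundaries `g ↦ g • m - m`. -/
def B1 : Submodule A (Z1 A G M) where
  carrier := {f | ∃ m : M, ∀ g, f.1 g = g • m - m}
  zero_mem' := ⟨0, fun g => by simp⟩
  add_mem' := by
    rintro a b ⟨m, hm⟩ ⟨n, hn⟩
    exact ⟨m + n, fun g => by
      simp only [Submodule.coe_add, Pi.add_apply, hm, hn, smul_add]; abel⟩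
  smul_mem' := by
    rintro c a ⟨m, hm⟩
    exact ⟨c • m, fun g => by
      simp only [Submodule.coe_smul, Pi.smul_apply, hm, smul_sub, smul_comm g c]⟩

/-- The continuous cohomology group `H¹(G, M)` of the discrete `G`-module `M`. -/
abbrev H1 : Type _ := Z1 A G M ⧸ B1 A G M

end Cohomology

/-! ### Drinfeld modules -/

lemma add_pow_card_pow (k : Type*) {B : Type*} [Field k] [Finite k] [CommRing B] [Algebra k[X] B]
    (x y : B) (i : ℕ) :
    (x + y) ^ Nat.card k ^ i = x ^ Nat.card k ^ i + y ^ Nat.card k ^ i := by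
  have := Fintype.ofFinite k
  let _ : Algebra k B := ((algebraMap k[X] B).comp Polynomial.C).toAlgebra
  have key : ∀ u v : B, (u + v) ^ Nat.card k = u ^ Nat.card k + v ^ Nat.card k := fun u v => by
    rw [Nat.card_eq_fintype_card]
    exact map_add (FiniteField.frobeniusAlgHom k B) u v
  induction i with
  | zero => simp
  | succ i ih => rw [pow_succ, pow_mul, ih, key, ← pow_mul, ← pow_mul]

lemma pow_card_pow_eq (k : Type*) [Field k] [Finite k] (c : k) (i : ℕ) :
    c ^ Nat.card k ^ i = c := by
  have := Fintype.ofFinite k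
  rw [Nat.card_eq_fintype_card]
  exact FiniteField.pow_card_pow i c

/-- A model over the `k[t]`-algebra `R` of a Drinfeld module of rank `rank`: the additive group
over `R`, with the `k`-algebra homomorphism `φ : k[t] → End(𝔾_a)` given by
`φ(t) = t + a₁ τ + ⋯ + a_n τⁿ`, where `aᵢ = coeff i`, `n = rank` and `a_n ≠ 0`. The rank `0` is
allowed. -/
structure DrinfeldModule (k R : Type*) [Field k] [CommRing R] [Algebra k[X] R] where
  /-- The rank `n`. -/
  rank : ℕ
  /-- The coefficients `aᵢ` of `φ(t)`. -/
  coeff : ℕ → R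
  coeff_zero : coeff 0 = algebraMap k[X] R Polynomial.X
  coeff_rank_ne_zero : coeff rank ≠ 0
  coeff_eq_zero : ∀ i, rank < i → coeff i = 0

namespace DrinfeldModule

section Points

variable {k R : Type*} [Field k] [CommRing R] [Algebra k[X] R] (E : DrinfeldModule k R)

section

variable (B : Type*) [CommRing B] [Algebra R B] [Finite k] [Algebra k[X] B]

/-- The action of `φ(t)` on `B`: `y ↦ ∑ aᵢ y^(qⁱ)`, with `q` the number of elements of `k`. -/
def phiT : AddMonoid.End B where
  toFun y := ∑ i ∈ Finset.range (E.rank + 1), algebraMap R B (E.coeff i) * y ^ Nat.card k ^ i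
  map_zero' := Finset.sum_eq_zero fun i _ => by
    rw [zero_pow (pow_ne_zero i (Nat.card_pos (α := k)).ne'), mul_zero]
  map_add' x y := by
    rw [← Finset.sum_add_distrib]
    exact Finset.sum_congr rfl fun i _ => by rw [add_pow_card_pow k, mul_add]

variable {B} in
lemma phiT_apply (y : B) : E.phiT B y =
    ∑ i ∈ Finset.range (E.rank + 1), algebraMap R B (E.coeff i) * y ^ Nat.card k ^ i := rfl

variable {B} in
lemma phiT_smul (c : k) (y : B) :
    E.phiT B (Polynomial.C c • y) = Polynomial.C c • E.phiT B y := by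
  simp only [phiT_apply, Finset.smul_sum]
  refine Finset.sum_congr rfl fun i _ => ?_
  rw [Algebra.smul_def, Algebra.smul_def, mul_pow, ← map_pow, ← map_pow, pow_card_pow_eq]
  ring

/-- The ring homomorphism `k[t] → End(B)` given by `φ`: constants `c ∈ k` act by multiplication
with `c`, and `t` acts as `φ(t)`. -/
def phi : k[X] →+* AddMonoid.End B :=
  Polynomial.eval₂RingHom' ((Module.toAddMonoidEnd k[X] B).comp Polynomial.C) (E.phiT B)
    fun c => show _ = _ from AddMonoidHom.ext fun y => (E.phiT_smul c y).symm

variable {B}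

lemma phi_C (c : k) (y : B) : E.phi B (Polynomial.C c) y = Polynomial.C c • y := by
  change (Polynomial.eval₂ _ _ (Polynomial.C c) : AddMonoid.End B) y = _
  rw [Polynomial.eval₂_C]
  rfl

lemma phi_X (y : B) : E.phi B Polynomial.X y = E.phiT B y := by
  change (Polynomial.eval₂ _ _ Polynomial.X : AddMonoid.End B) y = _
  rw [Polynomial.eval₂_X]

lemma algebraMap_phi [IsScalarTower k[X] R B] (p : k[X]) (y : R) :
    algebraMap R B (E.phi R p y) = E.phi B p (algebraMap R B y) := by
  induction p using Polynomial.induction_on generalizing y with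
  | C a =>
    rw [phi_C, phi_C, Algebra.smul_def, Algebra.smul_def, map_mul,
      ← IsScalarTower.algebraMap_apply]
  | add p q hp hq =>
    rw [map_add, map_add]
    exact (map_add (algebraMap R B) _ _).trans (congrArg₂ _ (hp y) (hq y))
  | monomial n a h =>
    rw [pow_succ, ← mul_assoc, map_mul (E.phi R), map_mul (E.phi B)]
    refine (h _).trans (congrArg _ ?_)
    refine (congrArg _ (E.phi_X y)).trans (Eq.trans ?_ (E.phi_X _).symm)
    simp [phiT_apply]

end

/-- `E(B)`: the additive group of `B` with the `k[t]`-module structure given by `φ`. The tangent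
space `Lie_E(B)` is `B` itself, with its structure of a module over `k[t]`. -/
def Points (_ : DrinfeldModule k R) (B : Type*) : Type _ := B

variable (B : Type*) [CommRing B]

instance : AddCommGroup (E.Points B) := inferInstanceAs (AddCommGroup B)

/-- The identification of the additive groups of `B` and `E(B)`. -/
def toPoints : B ≃+ E.Points B := AddEquiv.refl B

variable [Algebra R B] [Finite k] [Algebra k[X] B]

instance : Module k[X] (E.Points B) :=
  letI : Module (AddMonoid.End B) (E.Points B) := inferInstanceAs (Module (AddMonoid.End B) B)
  Module.compHom (E.Points B) (E.phi B)

variable {B} in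
lemma smul_toPoints (p : k[X]) (y : B) : p • E.toPoints B y = E.toPoints B (E.phi B p y) := rfl

/-- The map `E(R) → E(B)` induced by `R → B`. -/
def fromBase [IsScalarTower k[X] R B] : E.Points R →ₗ[k[X]] E.Points B where
  toFun y := E.toPoints B (algebraMap R B ((E.toPoints R).symm y))
  map_add' x y := by simp only [map_add]
  map_smul' p y := by
    obtain ⟨y, rfl⟩ := (E.toPoints R).surjective y
    rw [smul_toPoints, AddEquiv.symm_apply_apply, AddEquiv.symm_apply_apply, algebraMap_phi,
      RingHom.id_apply, smul_toPoints]

end Points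

/-! ### The exponential -/

section Exp

variable {k R : Type*} [Field k] [Finite k] [CommRing R] [Algebra k[X] R]
  (E : DrinfeldModule k R) (K : Type*) [Field K] [Algebra k[X] K] [Algebra R K]

/-- The coefficients `eᵢ` of the unique power series `exp_E(X) = ∑ eᵢ X^(qⁱ)` over `K` with
`e₀ = 1` and `φ(t)(exp_E(X)) = exp_E(t X)`, obtained by solving this equation recursively. -/
def expCoeff : ℕ → K
  | 0 => 1
  | i + 1 => (∑ j : Fin (i + 1),
      algebraMap R K (E.coeff (i + 1 - j)) * expCoeff j ^ Nat.card k ^ (i + 1 - j : ℕ)) /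
      (algebraMap k[X] K Polynomial.X ^ Nat.card k ^ (i + 1) - algebraMap k[X] K Polynomial.X)

/-- Equality of the coefficients of `X^(qⁱ)` in `φ(t)(exp_E(X)) = exp_E(t X)`. -/
lemma expCoeff_spec [IsScalarTower k[X] R K] (hK : Function.Injective (algebraMap k[X] K))
    (i : ℕ) :
    ∑ j ∈ Finset.range (i + 1),
      algebraMap R K (E.coeff (i - j)) * E.expCoeff K j ^ Nat.card k ^ (i - j) =
      E.expCoeff K i * algebraMap k[X] K Polynomial.X ^ Nat.card k ^ i := by
  have h0 : algebraMap R K (E.coeff 0) = algebraMap k[X] K Polynomial.X := by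
    rw [E.coeff_zero, ← IsScalarTower.algebraMap_apply]
  cases i with
  | zero => simp [h0, expCoeff]
  | succ i =>
    have hne : algebraMap k[X] K Polynomial.X ^ Nat.card k ^ (i + 1) -
        algebraMap k[X] K Polynomial.X ≠ 0 := by
      rw [← map_pow, ← map_sub]
      refine (map_ne_zero_iff _ hK).mpr ?_
      have h1 : 1 < Nat.card k ^ (i + 1) :=
        Nat.one_lt_pow (Nat.succ_ne_zero i) (Finite.one_lt_card (α := k))
      exact FiniteField.X_pow_card_sub_X_ne_zero k h1
    rw [Finset.sum_range_succ, Nat.sub_self, h0, pow_zero, pow_one]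
    have h2 : E.expCoeff K (i + 1) * (algebraMap k[X] K Polynomial.X ^ Nat.card k ^ (i + 1) -
        algebraMap k[X] K Polynomial.X) = ∑ j ∈ Finset.range (i + 1),
      algebraMap R K (E.coeff (i + 1 - j)) *
        E.expCoeff K j ^ Nat.card k ^ (i + 1 - j) := by
      rw [expCoeff, div_mul_cancel₀ _ hne, Finset.sum_range]
    rw [← h2]
    ring

variable {K} {B : Type*} [CommRing B] [Algebra K B] [TopologicalSpace B]

variable (K) in
/-- `exp_E(x) = y`, for `x ∈ Lie_E(B)` and `y ∈ E(B)`: the series `∑ eᵢ x^(qⁱ)` converges to `y`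
in `B`. -/
def ExpEq (x : B) (y : E.Points B) : Prop :=
  HasSum (fun i => algebraMap K B (E.expCoeff K i) * x ^ Nat.card k ^ i) ((E.toPoints B).symm y)

end Exp

section Main

open FunctionField

variable {k K : Type*} [Field k] [Finite k] [Field K] [Algebra k[X] K] [Algebra (RatFunc k) K]

section General

variable {L : Type*} [Field L] [Algebra (RatFunc k) L] [Algebra (LocalInfty k) L]
  [IsScalarTower (RatFunc k) (LocalInfty k) L]

lemma continuous_frob (i : ℕ) : Continuous fun x : Ext k K L => x ^ Nat.card k ^ i := by
  have hF : Continuous fun c : LocalInfty k => c ^ Nat.card k ^ i := continuous_pow _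
  exact IsModuleTopology.continuous_of_distribMulActionHomₑ (R := LocalInfty k)
    (σ := powMonoidHom (Nat.card k ^ i)) (S := LocalInfty k) hF
    { toFun := fun x : Ext k K L => x ^ Nat.card k ^ i
      map_smul' := fun c x => by
        simp only [Algebra.smul_def, mul_pow, powMonoidHom_apply, map_pow]
      map_zero' := zero_pow (pow_ne_zero i (Nat.card_pos (α := k)).ne')
      map_add' := fun x y => add_pow_card_pow k x y i }

variable {E : DrinfeldModule k (ringOfIntegers k K)}

lemma ExpEq.zero : E.ExpEq K (0 : Ext k K L) 0 := by
  have h : ∀ i, algebraMap K (Ext k K L) (E.expCoeff K i) * (0 : Ext k K L) ^ Nat.card k ^ i = 0 :=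
    fun i => by rw [zero_pow (pow_ne_zero i (Nat.card_pos (α := k)).ne'), mul_zero]
  rw [ExpEq, map_zero, funext h]
  exact hasSum_zero

lemma ExpEq.add {x x' : Ext k K L} {y y' : E.Points (Ext k K L)} (h : E.ExpEq K x y)
    (h' : E.ExpEq K x' y') : E.ExpEq K (x + x') (y + y') := by
  have := HasSum.add h h'
  simp only [ExpEq, map_add, add_pow_card_pow k, mul_add]
  exact this

lemma hasSum_mul_left (a : Ext k K L) {f : ℕ → Ext k K L} {s : Ext k K L} (h : HasSum f s) :
    HasSum (fun i => a * f i) (a * s) :=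
  h.map (AddMonoidHom.mulLeft a)
    (IsModuleTopology.continuous_of_linearMap (LinearMap.mulLeft (LocalInfty k) a))

lemma ExpEq.C_smul (c : k) {x : Ext k K L} {y : E.Points (Ext k K L)} (h : E.ExpEq K x y) :
    E.ExpEq K ((Polynomial.C c : k[X]) • x) ((Polynomial.C c : k[X]) • y) := by
  obtain ⟨y, rfl⟩ := (E.toPoints _).surjective y
  have := hasSum_mul_left (algebraMap k[X] (Ext k K L) (Polynomial.C c)) h
  rw [smul_toPoints, phi_C]
  simp only [ExpEq, Algebra.smul_def, mul_pow, AddEquiv.symm_apply_apply] at this ⊢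
  convert this using 2 with i
  rw [← map_pow, ← map_pow, pow_card_pow_eq]
  ring

lemma ExpEq.X_smul [IsScalarTower k[X] (RatFunc k) K] {x : Ext k K L} {y : E.Points (Ext k K L)}
    (h : E.ExpEq K x y) :
    E.ExpEq K ((Polynomial.X : k[X]) • x) ((Polynomial.X : k[X]) • y) := by
  obtain ⟨y, rfl⟩ := (E.toPoints _).surjective y
  rw [smul_toPoints, phi_X, ExpEq, AddEquiv.symm_apply_apply, phiT_apply]
  rw [ExpEq, AddEquiv.symm_apply_apply] at h
  set q := Nat.card k with hq
  let R := ringOfIntegers k K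
  let B := Ext k K L
  let f : ℕ → ℕ → B := fun j i => if j ≤ i then algebraMap R B (E.coeff j) *
    (algebraMap K B (E.expCoeff K (i - j)) * x ^ q ^ (i - j)) ^ q ^ j else 0
  have h1 : ∀ j, HasSum (f j) (algebraMap R B (E.coeff j) * y ^ q ^ j) := by
    intro j
    have h2 : HasSum (fun i => (algebraMap K B (E.expCoeff K i) * x ^ q ^ i) ^ q ^ j)
        (y ^ q ^ j) :=
      h.map (⟨⟨fun x => x ^ q ^ j, zero_pow (pow_ne_zero j (Nat.card_pos (α := k)).ne')⟩,
        fun x y => add_pow_card_pow k x y j⟩ : B →+ B) (continuous_frob j)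
    have h3 := hasSum_mul_left (algebraMap R B (E.coeff j)) h2
    refine (Function.Injective.hasSum_iff (add_left_injective j) ?_).mp ?_
    · intro i hi
      have : ¬ j ≤ i := fun hji => hi ⟨i - j, Nat.sub_add_cancel hji⟩
      simp only [f, if_neg this]
    · convert h3 using 2 with i
      simp [f]
  have h4 := hasSum_sum (s := Finset.range (E.rank + 1)) fun j _ => h1 j
  convert h4 using 2 with i
  have hinj : Function.Injective (algebraMap k[X] K) := FunctionField.algebraMap_injective k K
  let b : ℕ → K := fun j => if j ≤ i then algebraMap R K (E.coeff j) *
    E.expCoeff K (i - j) ^ q ^ j else 0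
  have h5 : ∑ j ∈ Finset.range (E.rank + 1), b j =
      E.expCoeff K i * algebraMap k[X] K Polynomial.X ^ q ^ i := by
    rw [← E.expCoeff_spec K hinj i]
    have e1 : ∑ j ∈ Finset.range (E.rank + 1), b j =
        ∑ j ∈ Finset.range (max E.rank i + 1), b j := by
      refine Finset.sum_subset (Finset.range_mono (by omega)) fun j _ hj => ?_
      have : E.rank < j := by simpa using hj
      simp [b, E.coeff_eq_zero j this]
    have e2 : ∑ j ∈ Finset.range (i + 1), b j =
        ∑ j ∈ Finset.range (max E.rank i + 1), b j := by
      refine Finset.sum_subset (Finset.range_mono (by omega)) fun j _ hj => ?_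
      have : ¬ j ≤ i := by simpa [Nat.lt_succ_iff] using hj
      simp [b, this]
    rw [e1, ← e2, ← Finset.sum_range_reflect]
    refine Finset.sum_congr rfl fun j hj => ?_
    have hj' : j ≤ i := Nat.lt_succ_iff.mp (Finset.mem_range.mp hj)
    have e3 : i + 1 - 1 - j = i - j := by omega
    have e4 : i - (i - j) = j := by omega
    simp only [b, e3, e4, if_pos (Nat.sub_le i j), hq, R]
  rw [Algebra.smul_def, mul_pow, ← mul_assoc, IsScalarTower.algebraMap_apply k[X] K (Ext k K L),
    ← map_pow, ← map_mul, ← h5, map_sum, Finset.sum_mul]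
  refine Finset.sum_congr rfl fun j _ => ?_
  by_cases hj : j ≤ i
  · simp only [b, f, if_pos hj, map_mul, map_pow, mul_pow]
    rw [← pow_mul, ← pow_add, Nat.sub_add_cancel hj, mul_assoc]
    rfl
  · simp only [b, f, if_neg hj, map_zero, zero_mul]

variable [IsScalarTower k[X] (RatFunc k) K]

lemma ExpEq.smul (p : k[X]) {x : Ext k K L} {y : E.Points (Ext k K L)} (h : E.ExpEq K x y) :
    E.ExpEq K (p • x) (p • y) := by
  induction p using Polynomial.induction_on generalizing x y with
  | C a => exact h.C_smul a
  | add p q hp hq =>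
    rw [add_smul, add_smul]
    exact (hp h).add (hq h)
  | monomial n a ih =>
    rw [pow_succ, ← mul_assoc, mul_smul _ _ x, mul_smul _ _ y]
    exact ih h.X_smul

end General

variable [IsScalarTower k[X] (RatFunc k) K] (E : DrinfeldModule k (ringOfIntegers k K))

/-- The inverse image `exp_E⁻¹(E(R))` in `Lie_E(K_∞)`. -/
def expPreimage : Submodule k[X] (KInfty k K) where
  carrier := {x | ∃ r : E.Points (ringOfIntegers k K), E.ExpEq K x (E.fromBase (KInfty k K) r)}
  zero_mem' := ⟨0, by rw [map_zero]; exact ExpEq.zero⟩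
  add_mem' := by
    rintro x y ⟨r, hr⟩ ⟨s, hs⟩
    exact ⟨r + s, by rw [map_add]; exact hr.add hs⟩
  smul_mem' := by
    rintro p x ⟨r, hr⟩
    exact ⟨p • r, by rw [map_smul]; exact hr.smul p⟩

section Lattice

variable (Ω : Type*) [Field Ω] [Algebra (RatFunc k) Ω] [Algebra (LocalInfty k) Ω]
  [IsScalarTower (RatFunc k) (LocalInfty k) Ω]

/-- The kernel `Λ_E` of `exp_E` in `Lie_E(K ⊗ Ω)`. -/
def periods : Submodule k[X] (Ext k K Ω) where
  carrier := {x | E.ExpEq K x 0}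
  zero_mem' := ExpEq.zero
  add_mem' {x y} hx hy := by simpa using ExpEq.add hx hy
  smul_mem' p x hx := by simpa using ExpEq.smul p hx

variable {E Ω} in
lemma ExpEq.gal (g : Gal(Ω/LocalInfty k)) {x : Ext k K Ω} {y : E.Points (Ext k K Ω)}
    (h : E.ExpEq K x y) :
    E.ExpEq K (g • x) (E.toPoints _ (g • (E.toPoints _).symm y)) := by
  have := h.map (galMap k K Ω g) (IsModuleTopology.continuous_of_linearMap
    (galMap k K Ω g).toLinearMap)
  rw [ExpEq, AddEquiv.symm_apply_apply]
  convert this using 2 with i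
  · simp only [Function.comp_apply, map_mul, map_pow, ← smul_def, smul_algebraMap]
  · rfl

instance : DistribMulAction Gal(Ω/LocalInfty k) (E.periods Ω) where
  smul g x := ⟨g • x.1, by
    have := ExpEq.gal g x.2
    rwa [map_zero, smul_zero, map_zero] at this⟩
  one_smul x := Subtype.ext (one_smul _ x.1)
  mul_smul g h x := Subtype.ext (mul_smul g h x.1)
  smul_zero g := Subtype.ext (smul_zero g)
  smul_add g x y := Subtype.ext (smul_add g x.1 y.1)

instance : SMulCommClass Gal(Ω/LocalInfty k) k[X] (E.periods Ω) where
  smul_comm g p x := Subtype.ext (smul_comm g p x.1)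

/-- `H¹(G, Λ_E)` with `G = Gal(Ω/k((t⁻¹)))`; here `Λ_E` is a discrete `G`-module. -/
abbrev H1Periods : Type _ := H1 k[X] Gal(Ω/LocalInfty k) (E.periods Ω)

/-- `δ` is the connecting homomorphism `E(K_∞) → H¹(G, Λ_E)` of the short exact sequence
`0 → Λ_E → Lie_E(K_∞^sep) → E(K_∞^sep) → 0`: each `y ∈ E(K_∞)` has a preimage `x` under `exp_E`
in `Lie_E(K_∞^sep)`, and for every such `x` the map `g ↦ g x - x` is a continuous cocycle with
values in `Λ_E`, of class `δ y`. -/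
def IsConnecting (δ : E.Points (KInfty k K) →ₗ[k[X]] E.H1Periods Ω) : Prop :=
  ∀ y : KInfty k K,
    (∃ x : Ext k K Ω, E.ExpEq K x (E.toPoints _ (toSep k K Ω y))) ∧
    ∀ x : Ext k K Ω, E.ExpEq K x (E.toPoints _ (toSep k K Ω y)) →
      ∃ f : Z1 k[X] Gal(Ω/LocalInfty k) (E.periods Ω),
        (∀ g, (f.1 g : Ext k K Ω) = g • x - x) ∧
        δ (E.toPoints _ y) = (B1 k[X] Gal(Ω/LocalInfty k) (E.periods Ω)).mkQ f

end Lattice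

end Main

end DrinfeldModule

end DrinfeldUnits

end

/-!
Write `F = k((t⁻¹))` and let `‖·‖` be an absolute value of `F`. The recursion for the coefficients
`eᵢ` divides by `t ^ (q ^ i) - t`, of absolute value `‖t‖ ^ (q ^ i)`; hence `‖eᵢ‖ ^ (1 / q ^ i)`
decays geometrically for every submultiplicative norm (`exists_decay`, `summable_norm_expCoeff`).
Each element of `K ⊗ L`, for `L` algebraic over `F`, lies in a finite-dimensional `F`-subalgebra
containing `K`, on which there is such a norm, so that `exp_E` converges everywhere
(`existsUnique_expEq`). As `exp_E` is additive with linear term `X`, it is invertible near `0` on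
complete algebras (`exists_local_inverse`).

*Surjectivity on `K ⊗ Ω`.* The residue fields `M` of the artinian ring `K ⊗ Ω` are separably closed
and algebraic over `F`. The sum of the inverses of the roots of `φ(t)(z) = y` is `t / y`, so some
root satisfies `‖z‖ ≤ ‖y‖ / ‖t‖` (`exists_small_root`). Dividing by `φ(t)` repeatedly, one reaches
the domain of the local inverse, and the functional equation gives `y` as a value of `exp_E` on `M`
(`exists_expEq_map_eq`). The values found on the residue fields are combined by the Chinese remainder
theorem, up to a nilpotent error, and `exp_E` maps the nilradical onto itself
(`exists_expEq_of_pow_eq_zero`). No separability of `K` over `k(t)` is needed.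

*The lattice.* The ring `R` is discrete in `K_∞`: an element of norm less than `1` is topologically
nilpotent, and the powers of an integral element have a common denominator, so it is nilpotent
(`exists_nhds_zero_integers`). It is cocompact because it contains a basis of `K` and `F / k[t]` is
compact. As `exp_E` is open on `K_∞`, the quotient by `exp_E⁻¹(E(R))` is an open, hence closed,
subgroup of the compact group `K_∞ / R`.

*The cokernel.* By the additive form of Hilbert 90, `H¹(G, K ⊗ Ω) = 0` (`exists_eq_smul_sub`), so
that `δ` is surjective. It vanishes on `exp_E(K_∞)`, which is open in `K_∞`. The cokernel is thus
a quotient of the compact group `K_∞ / R` by an open subgroup, and finite (`finite_cokernel`).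
-/

open scoped Polynomial TensorProduct

noncomputable section

namespace DrinfeldUnits

/-! ### The field `k((t⁻¹))` as a normed field -/

section LocalField

open WithZero Filter Topology
open scoped Classical Valued

variable (k : Type*) [Field k]

section
open scoped RatFunc.CompletionAtInfty
attribute [-instance] RatFunc.valuedRatFunc

instance : CompleteSpace (LocalInfty k) :=
  inferInstanceAs (CompleteSpace (UniformSpace.Completion (RatFunc k)))

lemma denseRange_algebraMap : DenseRange (algebraMap (RatFunc k) (LocalInfty k)) :=
  UniformSpace.Completion.denseRange_coe (α := RatFunc k)

variable {k} in
lemma valued_algebraMap (f : RatFunc k) :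
    Valued.v (algebraMap (RatFunc k) (LocalInfty k) f) = RatFunc.inftyValuation k f := by
  let := RatFunc.inftyValued k
  exact Valued.valuedCompletion_apply f

end

variable {k} in
/-- The image of `t` in `k((t⁻¹))`. -/
def tInfty : LocalInfty k := algebraMap (RatFunc k) (LocalInfty k) RatFunc.X

lemma valued_tInfty : Valued.v (tInfty : LocalInfty k) = (exp 1 : ℤᵐ⁰) := by
  rw [tInfty, valued_algebraMap, RatFunc.inftyValuation.X]

/-- A rank one structure on the valuation of `k((t⁻¹))`; it fixes an absolute value. -/
@[reducible] def rankOneLocalInfty : (Valued.v : Valuation (LocalInfty k) ℤᵐ⁰).RankOne :=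
  haveI : (Valued.v : Valuation (LocalInfty k) ℤᵐ⁰).IsNontrivial :=
    ⟨tInfty, by rw [valued_tInfty]; simp, by rw [valued_tInfty]; simp⟩
  (Valuation.nonempty_rankOne_iff_mulArchimedean.mpr (MulArchimedean.comap
    (MonoidWithZeroHom.ValueGroup₀.embedding (f := MonoidWithZeroHom.ofClass
      (Valued.v : Valuation (LocalInfty k) ℤᵐ⁰))).toMonoidHom
    MonoidWithZeroHom.ValueGroup₀.embedding_strictMono)).some

attribute [local instance] rankOneLocalInfty

/-- The absolute value of `k((t⁻¹))`, normalized in an unspecified way. Its topology is the given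
one. -/
@[reducible] def normedLocalInfty : NontriviallyNormedField (LocalInfty k) :=
  Valued.toNontriviallyNormedField (LocalInfty k) ℤᵐ⁰

attribute [local instance] normedLocalInfty

instance : IsUltrametricDist (LocalInfty k) :=
  inferInstanceAs (IsUltrametricDist (LocalInfty k))

lemma norm_lt_one_iff_valued (x : LocalInfty k) : ‖x‖ < 1 ↔ Valued.v x < 1 :=
  Valued.toNormedField.norm_lt_one_iff

lemma norm_le_one_iff_valued (x : LocalInfty k) : ‖x‖ ≤ 1 ↔ Valued.v x ≤ 1 :=
  Valued.toNormedField.norm_le_one_iff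

variable {k}

lemma one_lt_norm_tInfty : 1 < ‖(tInfty : LocalInfty k)‖ := by
  rw [Valued.toNormedField.one_lt_norm_iff, valued_tInfty, ← exp_zero, exp_lt_exp]
  exact zero_lt_one

/-- The image of a polynomial in `k((t⁻¹))`. -/
abbrev polyInfty (p : k[X]) : LocalInfty k :=
  algebraMap (RatFunc k) (LocalInfty k) (algebraMap k[X] (RatFunc k) p)

lemma valued_polyInfty {p : k[X]} (hp : p ≠ 0) :
    Valued.v (polyInfty p) = (exp (p.natDegree : ℤ) : ℤᵐ⁰) := by
  rw [valued_algebraMap, RatFunc.inftyValuation_apply, RatFunc.inftyValuation.polynomial k hp]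

lemma one_le_norm_polyInfty {p : k[X]} (hp : p ≠ 0) : 1 ≤ ‖polyInfty p‖ := by
  rw [Valued.toNormedField.one_le_norm_iff, valued_polyInfty hp, ← exp_zero, exp_le_exp]
  exact Int.natCast_nonneg _

/-- Division with remainder: every rational function is a polynomial up to a rational function
of negative degree. -/
lemma exists_polynomial_norm_sub_lt_one (f : RatFunc k) :
    ∃ p : k[X], ‖algebraMap (RatFunc k) (LocalInfty k) f - polyInfty p‖ < 1 := by
  have hd := f.denom_ne_zero
  refine ⟨f.num / f.denom, ?_⟩
  have h0 : algebraMap k[X] (RatFunc k) f.denom ≠ 0 :=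
    (map_ne_zero_iff _ (IsFractionRing.injective k[X] (RatFunc k))).mpr hd
  have h1 : f - algebraMap k[X] (RatFunc k) (f.num / f.denom) =
      algebraMap k[X] (RatFunc k) (f.num % f.denom) / algebraMap k[X] (RatFunc k) f.denom := by
    rw [eq_div_iff h0, sub_mul, ← map_mul, EuclideanDomain.mod_eq_sub_mul_div, map_sub]
    congr 1
    · nth_rw 1 [← f.num_div_denom]
      rw [div_mul_cancel₀ _ h0]
    · rw [mul_comm]
  rw [polyInfty, ← map_sub, h1, map_div₀, norm_div]
  by_cases hr : f.num % f.denom = 0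
  · rw [hr, map_zero, map_zero, norm_zero, zero_div]
    exact zero_lt_one
  rw [div_lt_one (lt_of_lt_of_le zero_lt_one (one_le_norm_polyInfty hd)),
    Valued.toNormedField.norm_lt_iff, valued_polyInfty hr, valued_polyInfty hd, exp_lt_exp]
  exact_mod_cast Polynomial.natDegree_lt_natDegree hr (EuclideanDomain.mod_lt _ hd)

/-- `k((t⁻¹)) = k[t] + t⁻¹ k[[t⁻¹]]`. -/
lemma exists_polynomial_near (x : LocalInfty k) : ∃ p : k[X], ‖x - polyInfty p‖ < 1 := by
  obtain ⟨f, hf⟩ := Metric.denseRange_iff.mp (denseRange_algebraMap k) x 1 zero_lt_one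
  obtain ⟨p, hp⟩ := exists_polynomial_norm_sub_lt_one f
  refine ⟨p, ?_⟩
  rw [← sub_add_sub_cancel x (algebraMap (RatFunc k) (LocalInfty k) f)]
  rw [dist_eq_norm] at hf
  exact (IsUltrametricDist.norm_add_le_max _ _).trans_lt (max_lt hf hp)

lemma exists_C_near {x : LocalInfty k} (hx : ‖x‖ ≤ 1) :
    ∃ c : k, ‖tInfty * (x - polyInfty (Polynomial.C c))‖ ≤ 1 := by
  obtain ⟨p, hp⟩ := exists_polynomial_near x
  have h1 : ‖polyInfty p‖ ≤ 1 := by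
    rw [← sub_sub_cancel x (polyInfty p), sub_eq_add_neg]
    refine (IsUltrametricDist.norm_add_le_max _ _).trans (max_le hx ?_)
    rw [norm_neg]
    exact hp.le
  have h2 : p.natDegree = 0 := by
    by_cases h0 : p = 0
    · simp [h0]
    rw [norm_le_one_iff_valued, valued_polyInfty h0, ← exp_zero, exp_le_exp] at h1
    exact_mod_cast le_antisymm h1 (Int.natCast_nonneg _)
  refine ⟨p.coeff 0, ?_⟩
  rw [← Polynomial.eq_C_of_natDegree_eq_zero h2, norm_le_one_iff_valued, map_mul, valued_tInfty]
  rw [norm_lt_one_iff_valued] at hp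
  -- the value group is discrete, so `v < 1` means `v ≤ exp (-1)`
  by_cases h0 : Valued.v (x - polyInfty p) = (0 : ℤᵐ⁰)
  · rw [h0, mul_zero]
    exact zero_le_one
  rw [← exp_log h0, ← exp_zero, exp_lt_exp] at hp
  rw [← exp_log h0, ← exp_add, ← exp_zero, exp_le_exp]
  omega

lemma exists_finite_approx [Finite k] (n : ℕ) : ∃ S : Set (LocalInfty k), S.Finite ∧
    ∀ x : LocalInfty k, ‖x‖ ≤ 1 → ∃ s ∈ S, ‖tInfty ^ n * (x - s)‖ ≤ 1 := by
  induction n with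
  | zero => exact ⟨{0}, Set.finite_singleton 0, fun x hx => ⟨0, rfl, by simpa using hx⟩⟩
  | succ n ih =>
    obtain ⟨S, hS, h⟩ := ih
    refine ⟨(fun a : k × LocalInfty k => polyInfty (Polynomial.C a.1) + tInfty⁻¹ * a.2) ''
      (Set.univ ×ˢ S), (Set.finite_univ.prod hS).image _, fun x hx => ?_⟩
    obtain ⟨c, hc⟩ := exists_C_near hx
    obtain ⟨s, hs, hxs⟩ := h _ hc
    refine ⟨_, ⟨(c, s), ⟨trivial, hs⟩, rfl⟩, ?_⟩
    have h0 : (tInfty : LocalInfty k) ≠ 0 := by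
      intro h0
      have := one_lt_norm_tInfty (k := k)
      rw [h0, norm_zero] at this
      linarith
    convert hxs using 2
    field_simp
    ring

lemma isCompact_closedBall_localInfty [Finite k] :
    IsCompact (Metric.closedBall (0 : LocalInfty k) 1) := by
  refine isCompact_iff_totallyBounded_isComplete.mpr ⟨?_, Metric.isClosed_closedBall.isComplete⟩
  rw [Metric.totallyBounded_iff]
  intro ε hε
  have h1 := one_lt_norm_tInfty (k := k)
  obtain ⟨n, hn⟩ := pow_unbounded_of_one_lt ε⁻¹ h1
  obtain ⟨S, hS, h⟩ := exists_finite_approx (k := k) n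
  refine ⟨S, hS, fun x hx => ?_⟩
  obtain ⟨s, hs, hxs⟩ := h x (by simpa using hx)
  simp only [Set.mem_iUnion]
  refine ⟨s, hs, ?_⟩
  rw [Metric.mem_ball, dist_eq_norm]
  rw [norm_mul, norm_pow] at hxs
  have h2 : 0 < ‖(tInfty : LocalInfty k)‖ ^ n := by positivity
  calc ‖x - s‖ ≤ (‖(tInfty : LocalInfty k)‖ ^ n)⁻¹ := by
        rw [← one_div, le_div_iff₀ h2, mul_comm]; exact hxs
    _ < ε := inv_lt_of_inv_lt₀ hε hn

end LocalField

/-! ### Entire `q`-power series and additive perturbations of the identity -/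

section Analysis

open Filter Topology

/-- Super-exponential decay of the coefficients of the exponential, as a statement about the real
numbers `u i = ‖eᵢ‖`. With `s ^ n * ρ > 1`, the bound `u i ≤ (M * s ^ i) ^ q ^ i` propagates
through the recursion as soon as `i` is large, and it holds for small `i` if `M` is large. -/
lemma exists_decay {q : ℕ} (hq : 2 ≤ q) {n : ℕ} {ρ : ℝ} (hρ : 1 < ρ) {u a : ℕ → ℝ}
    (hu : ∀ i, 0 ≤ u i) (ha : ∀ i, 0 ≤ a i) (ha0 : ∀ i, n < i → a i = 0)
    (h : ∀ i, u (i + 1) ≤ (ρ ^ q ^ (i + 1))⁻¹ *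
      ∑ j ∈ Finset.range (i + 1), a (i + 1 - j) * u j ^ q ^ (i + 1 - j)) :
    ∃ M s : ℝ, 0 < M ∧ 0 < s ∧ s < 1 ∧ ∀ i, u i ≤ (M * s ^ i) ^ q ^ i := by
  have hρ0 : 0 < ρ := by linarith
  obtain ⟨s, hs0, hs1, hsρ⟩ : ∃ s : ℝ, 0 < s ∧ s < 1 ∧ 1 < ρ * s ^ n := by
    refine ⟨(ρ⁻¹) ^ (((n + 1 : ℕ) : ℝ)⁻¹), by positivity,
      Real.rpow_lt_one (by positivity) (inv_lt_one_of_one_lt₀ hρ) (by positivity), ?_⟩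
    set s := (ρ⁻¹) ^ (((n + 1 : ℕ) : ℝ)⁻¹) with hs
    have h1 : s ^ (n + 1) = ρ⁻¹ := Real.rpow_inv_natCast_pow (by positivity) (Nat.succ_ne_zero n)
    have h0 : 0 < s := by positivity
    have h2 : s < 1 :=
      Real.rpow_lt_one (by positivity) (inv_lt_one_of_one_lt₀ hρ) (by positivity)
    have h3 : ρ * s ^ n * s = 1 := by rw [mul_assoc, ← pow_succ, h1, mul_inv_cancel₀ hρ0.ne']
    have h4 : 0 < ρ * s ^ n := by positivity
    nlinarith
  set C := ∑ m ∈ Finset.range (n + 1), a m with hC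
  obtain ⟨N, hN⟩ := pow_unbounded_of_one_lt C hsρ
  set M := 1 + ∑ i ∈ Finset.range (N + 1), (1 + u i) / s ^ i with hM
  have hterm : ∀ i, 0 ≤ (1 + u i) / s ^ i := fun i => by have := hu i; positivity
  have hM0 : 0 < M := by
    have : 0 ≤ ∑ i ∈ Finset.range (N + 1), (1 + u i) / s ^ i := Finset.sum_nonneg fun i _ => hterm i
    linarith
  have hsmall : ∀ i, i ≤ N → u i ≤ (M * s ^ i) ^ q ^ i := by
    intro i hi
    have h1 : (1 + u i) / s ^ i ≤ M := by
      have := Finset.single_le_sum (f := fun i => (1 + u i) / s ^ i) (fun i _ => hterm i)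
        (Finset.mem_range.mpr (Nat.lt_succ_of_le hi))
      linarith
    rw [div_le_iff₀ (by positivity)] at h1
    have h2 : 1 ≤ M * s ^ i := by linarith [hu i]
    calc u i ≤ M * s ^ i := by linarith
      _ ≤ (M * s ^ i) ^ q ^ i := le_self_pow₀ h2 (pow_ne_zero _ (by omega))
  refine ⟨M, s, hM0, hs0, hs1, fun i => ?_⟩
  induction i using Nat.strong_induction_on with
  | _ i ih =>
    rcases le_or_gt i N with hi | hi
    · exact hsmall i hi
    obtain ⟨i, rfl⟩ : ∃ l, i = l + 1 := ⟨i - 1, by omega⟩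
    set Q := q ^ (i + 1) with hQ
    have hNQ : N ≤ Q := hi.le.trans (Nat.lt_pow_self (by omega : 1 < q)).le
    have h1 : ∀ j ∈ Finset.range (i + 1), a (i + 1 - j) * u j ^ q ^ (i + 1 - j) ≤
        a (i + 1 - j) * (M * s ^ (i + 1) / s ^ n) ^ Q := by
      intro j hj
      have hj' : j < i + 1 := Finset.mem_range.mp hj
      rcases lt_or_ge n (i + 1 - j) with hn | hn
      · rw [ha0 _ hn, zero_mul, zero_mul]
      refine mul_le_mul_of_nonneg_left ?_ (ha _)
      calc u j ^ q ^ (i + 1 - j) ≤ ((M * s ^ j) ^ q ^ j) ^ q ^ (i + 1 - j) :=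
            pow_le_pow_left₀ (hu j) (ih j hj') _
        _ = (M * s ^ j) ^ Q := by
            rw [← pow_mul, ← pow_add, Nat.add_sub_cancel' hj'.le]
        _ ≤ _ := by
            refine pow_le_pow_left₀ (by positivity) ?_ _
            rw [mul_div_assoc]
            refine mul_le_mul_of_nonneg_left ?_ hM0.le
            rw [le_div_iff₀ (by positivity), ← pow_add]
            exact pow_le_pow_of_le_one hs0.le hs1.le (by omega)
    have h2 : ∑ j ∈ Finset.range (i + 1), a (i + 1 - j) ≤ C := by
      have e1 : ∑ j ∈ Finset.range (i + 1), a (i + 1 - j) =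
          ∑ j ∈ Finset.range (i + 1), a (j + 1) := by
        rw [← Finset.sum_range_reflect]
        refine Finset.sum_congr rfl fun j hj => ?_
        have := Finset.mem_range.mp hj
        congr 1
        omega
      have e2 : ∑ j ∈ Finset.range (i + 1), a (j + 1) ≤ ∑ j ∈ Finset.range (i + 1 + 1), a j := by
        rw [Finset.sum_range_succ' _ (i + 1)]
        exact le_add_of_nonneg_right (ha 0)
      have e3 : ∑ j ∈ Finset.range (i + 1 + 1), a j ≤
          ∑ j ∈ Finset.range (max (i + 1) n + 1), a j :=
        Finset.sum_le_sum_of_subset_of_nonneg (Finset.range_mono (by omega)) fun j _ _ => ha j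
      have e4 : C = ∑ j ∈ Finset.range (max (i + 1) n + 1), a j := by
        refine Finset.sum_subset (Finset.range_mono (by omega)) fun j _ hj => ha0 j ?_
        simpa using hj
      linarith
    have hsQ : 0 < s ^ n := by positivity
    calc u (i + 1) ≤ _ := h i
      _ ≤ (ρ ^ Q)⁻¹ * ∑ j ∈ Finset.range (i + 1),
          a (i + 1 - j) * (M * s ^ (i + 1) / s ^ n) ^ Q :=
        mul_le_mul_of_nonneg_left (Finset.sum_le_sum h1) (by positivity)
      _ ≤ (ρ ^ Q)⁻¹ * (C * (M * s ^ (i + 1) / s ^ n) ^ Q) := by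
        rw [← Finset.sum_mul]
        gcongr
      _ = C / (ρ * s ^ n) ^ Q * (M * s ^ (i + 1)) ^ Q := by
        rw [div_pow, mul_pow ρ]
        field_simp
      _ ≤ 1 * (M * s ^ (i + 1)) ^ Q := by
        gcongr
        rw [div_le_one (by positivity)]
        exact hN.le.trans (pow_le_pow_right₀ hsρ.le hNQ)
      _ = _ := one_mul _

lemma summable_of_decay {q : ℕ} (hq : 2 ≤ q) {M s : ℝ} (hM : 0 < M) (hs : 0 < s) (hs1 : s < 1)
    {u : ℕ → ℝ} (hu : ∀ i, 0 ≤ u i) (h : ∀ i, u i ≤ (M * s ^ i) ^ q ^ i) {r : ℝ} (hr : 0 ≤ r) :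
    Summable fun i => u i * r ^ q ^ i := by
  have h1 : Tendsto (fun i : ℕ => M * r * s ^ i) atTop (𝓝 (M * r * 0)) :=
    (tendsto_pow_atTop_nhds_zero_of_lt_one hs.le hs1).const_mul _
  rw [mul_zero] at h1
  refine Summable.of_norm_bounded_eventually_nat (g := fun i => (1 / 2 : ℝ) ^ i)
    summable_geometric_two ?_
  filter_upwards [h1.eventually (gt_mem_nhds (by norm_num : (0 : ℝ) < 1 / 2))] with i hi
  have h0 := hu i
  rw [Real.norm_of_nonneg (by positivity)]
  calc u i * r ^ q ^ i ≤ (M * s ^ i) ^ q ^ i * r ^ q ^ i := by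
        gcongr
        exact h i
    _ = (M * r * s ^ i) ^ q ^ i := by rw [← mul_pow]; ring
    _ ≤ (1 / 2) ^ q ^ i := pow_le_pow_left₀ (by positivity) hi.le _
    _ ≤ (1 / 2) ^ i :=
        pow_le_pow_of_le_one (by norm_num) (by norm_num) (Nat.lt_pow_self (by omega : 1 < q)).le

/-- An additive map which is contracting near `0` is a perturbation of the identity which can be
inverted near `0` by the series `∑ (-g)ⁿ`. -/
lemma exists_add_apply_eq {A : Type*} [NormedAddCommGroup A] [CompleteSpace A] (g : A →+ A) {r : ℝ}
    (hr : 0 < r) (hg : ∀ x, ‖x‖ < r → ‖g x‖ ≤ ‖x‖ / 2) {y : A} (hy : ‖y‖ < r) :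
    ∃ x, ‖x‖ ≤ 2 * ‖y‖ ∧ x + g x = y := by
  have hcont : Continuous g := by
    refine continuous_of_continuousAt_zero g ?_
    rw [ContinuousAt, map_zero]
    refine squeeze_zero_norm' (a := fun x => ‖x‖ / 2) ?_ ?_
    · filter_upwards [Metric.ball_mem_nhds (0 : A) hr] with x hx
      exact hg x (by simpa using hx)
    · have : Tendsto (fun x : A => ‖x‖ / 2) (𝓝 0) (𝓝 (‖(0 : A)‖ / 2)) :=
        (continuous_norm.div_const 2).tendsto 0
      simpa using this
  let f : ℕ → A := fun n => (fun x => -g x)^[n] y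
  have hf0 : f 0 = y := rfl
  have hfs : ∀ n, f (n + 1) = -g (f n) := fun n => Function.iterate_succ_apply' _ _ _
  have hfn : ∀ n, ‖f n‖ ≤ ‖y‖ * (1 / 2) ^ n := by
    intro n
    induction n with
    | zero => simp [hf0]
    | succ n ih =>
      have h1 : ‖f n‖ < r := ih.trans_lt <| lt_of_le_of_lt
        (mul_le_of_le_one_right (norm_nonneg y) (pow_le_one₀ (by norm_num) (by norm_num))) hy
      rw [hfs, norm_neg, pow_succ]
      linarith [hg _ h1]
  have hg2 : HasSum (fun n : ℕ => ‖y‖ * (1 / 2 : ℝ) ^ n) (‖y‖ * 2) :=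
    hasSum_geometric_two.mul_left _
  have hs : Summable f := Summable.of_norm_bounded hg2.summable hfn
  refine ⟨∑' n, f n, ?_, ?_⟩
  · rw [mul_comm]
    exact tsum_of_norm_bounded hg2 hfn
  · have h1 : HasSum (fun n => g (f n)) (g (∑' n, f n)) := hs.hasSum.map g hcont
    have h2 : HasSum (fun n => f (n + 1)) (-g (∑' n, f n)) := by
      simp only [hfs]
      exact h1.neg
    have h3 := hs.tsum_eq_zero_add
    rw [h2.tsum_eq, hf0] at h3
    nth_rw 1 [h3]
    abel

lemma exists_radius (S : ℝ) : ∃ r : ℝ, 0 < r ∧ r ≤ 1 ∧ r * (2 * S) ≤ 1 := by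
  refine ⟨min 1 (1 / (2 * (|S| + 1))), by positivity, min_le_left _ _, ?_⟩
  have h1 : min 1 (1 / (2 * (|S| + 1))) * (2 * (|S| + 1)) ≤ 1 := by
    rw [← le_div_iff₀ (by positivity)]
    exact min_le_right _ _
  have h2 : 0 < min 1 (1 / (2 * (|S| + 1))) := by positivity
  nlinarith [le_abs_self S]

/-- An entire `q`-power series with linear term `X` is a local isomorphism at `0`, on every ball
whose radius satisfies an explicit bound. -/
lemma exists_local_inverse_of_radius {A : Type*} [NormedCommRing A] [CompleteSpace A] {q : ℕ}
    (hq : 2 ≤ q) (hadd : ∀ (x y : A) (i : ℕ), (x + y) ^ q ^ i = x ^ q ^ i + y ^ q ^ i) {e : ℕ → A}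
    (he0 : e 0 = 1) (he : ∀ r : ℝ, 0 ≤ r → Summable fun i => ‖e i‖ * r ^ q ^ i) {r : ℝ}
    (hr : 0 < r) (hr1 : r ≤ 1) (hrS : r * (2 * ∑' i, ‖e (i + 1)‖) ≤ 1) :
    (∀ x y, ‖x‖ < r → HasSum (fun i => e i * x ^ q ^ i) y → ‖x‖ ≤ 2 * ‖y‖ ∧ ‖y‖ ≤ 2 * ‖x‖) ∧
      ∀ y, ‖y‖ < r → ∃ x, ‖x‖ ≤ 2 * ‖y‖ ∧ HasSum (fun i => e i * x ^ q ^ i) y := by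
  have hq0 : ∀ i, 0 < q ^ i := fun i => pow_pos (by omega) i
  have hnorm : ∀ x i, ‖e i * x ^ q ^ i‖ ≤ ‖e i‖ * ‖x‖ ^ q ^ i := fun x i =>
    (norm_mul_le _ _).trans (by gcongr; exact norm_pow_le' x (hq0 i))
  have hsum : ∀ x, Summable fun i => e i * x ^ q ^ i := fun x =>
    Summable.of_norm_bounded (he ‖x‖ (norm_nonneg x)) (hnorm x)
  have hsum' : ∀ x, Summable fun i => e (i + 1) * x ^ q ^ (i + 1) := fun x =>
    (hsum x).comp_injective (add_left_injective 1)
  let g : A →+ A :=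
    { toFun x := ∑' i, e (i + 1) * x ^ q ^ (i + 1)
      map_zero' := by
        simp only [zero_pow (hq0 _).ne', mul_zero, tsum_zero]
      map_add' x y := by
        simp only [hadd, mul_add]
        exact Summable.tsum_add (hsum' x) (hsum' y) }
  have hexp : ∀ x, HasSum (fun i => e i * x ^ q ^ i) (x + g x) := by
    intro x
    have h := (hsum x).hasSum
    rwa [(hsum x).tsum_eq_zero_add, he0, pow_zero, pow_one, one_mul] at h
  set S := ∑' i, ‖e (i + 1)‖ with hS
  have hS0 : 0 ≤ S := tsum_nonneg fun i => norm_nonneg _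
  have hSs : Summable fun i => ‖e (i + 1)‖ := by
    have := he 1 zero_le_one
    simp only [one_pow, mul_one] at this
    exact (summable_nat_add_iff 1).mpr this
  have hg : ∀ x, ‖x‖ < r → ‖g x‖ ≤ ‖x‖ / 2 := by
    intro x hx
    have hx1 : ‖x‖ ≤ 1 := hx.le.trans hr1
    have h1 : ‖g x‖ ≤ S * ‖x‖ ^ 2 := by
      refine tsum_of_norm_bounded (hSs.hasSum.mul_right (‖x‖ ^ 2)) fun i => ?_
      refine (hnorm x _).trans (mul_le_mul_of_nonneg_left ?_ (norm_nonneg _))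
      refine pow_le_pow_of_le_one (norm_nonneg x) hx1 ?_
      calc 2 ≤ q := hq
        _ ≤ q ^ (i + 1) := Nat.le_self_pow (Nat.succ_ne_zero i) q
    have h2 : ‖x‖ * (2 * S) ≤ 1 :=
      (mul_le_mul_of_nonneg_right hx.le (by positivity)).trans hrS
    nlinarith [norm_nonneg x]
  refine ⟨fun x y hx hxy => ?_, fun y hy => ?_⟩
  · have h1 : y = x + g x := hxy.unique (hexp x)
    have h2 := hg x hx
    constructor
    · have h3 : x = y - g x := by rw [h1]; abel
      have := norm_sub_le y (g x)
      rw [← h3] at this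
      linarith
    · have := norm_add_le x (g x)
      rw [← h1] at this
      linarith [norm_nonneg x]
  · obtain ⟨x, hx, rfl⟩ := exists_add_apply_eq g hr hg hy
    exact ⟨x, hx, hexp x⟩

lemma exists_local_inverse {A : Type*} [NormedCommRing A] [CompleteSpace A] {q : ℕ} (hq : 2 ≤ q)
    (hadd : ∀ (x y : A) (i : ℕ), (x + y) ^ q ^ i = x ^ q ^ i + y ^ q ^ i) {e : ℕ → A}
    (he0 : e 0 = 1) (he : ∀ r : ℝ, 0 ≤ r → Summable fun i => ‖e i‖ * r ^ q ^ i) :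
    ∃ r : ℝ, 0 < r ∧
      (∀ x y, ‖x‖ < r → HasSum (fun i => e i * x ^ q ^ i) y → ‖x‖ ≤ 2 * ‖y‖ ∧ ‖y‖ ≤ 2 * ‖x‖) ∧
      ∀ y, ‖y‖ < r → ∃ x, ‖x‖ ≤ 2 * ‖y‖ ∧ HasSum (fun i => e i * x ^ q ^ i) y := by
  obtain ⟨r, hr, hr1, hrS⟩ := exists_radius (∑' i, ‖e (i + 1)‖)
  exact ⟨r, hr, exists_local_inverse_of_radius hq hadd he0 he hr hr1 hrS⟩

end Analysis

/-! ### Normed models of finite-dimensional algebras and convergence of the exponential -/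

section Model

universe u

open Filter Topology FunctionField

section Norm
attribute [local instance] Matrix.linftyOpNormedRing Matrix.linftyOpNormedAlgebra

/-- A finite-dimensional commutative algebra over a complete field has a submultiplicative norm:
the operator norm of the matrices of multiplication. -/
lemma exists_normed_model (F : Type*) [NontriviallyNormedField F] [CompleteSpace F] {S : Type u}
    [CommRing S] [Algebra F S] [Module.Finite F S] :
    ∃ (A : Type u) (_ : NormedCommRing A) (_ : NormedAlgebra F A) (_ : CompleteSpace A),
      Nonempty (S ≃ₐ[F] A) := by
  classical
  let b := Module.finBasis F S
  let i1 : NormedCommRing S := NormedCommRing.induced S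
    (Matrix (Fin (Module.finrank F S)) (Fin (Module.finrank F S)) F) (Algebra.leftMulMatrix b)
    (Algebra.leftMulMatrix_injective b)
  let i2 : NormedAlgebra F S := NormedAlgebra.induced F S
    (Matrix (Fin (Module.finrank F S)) (Fin (Module.finrank F S)) F) (Algebra.leftMulMatrix b)
  have : FiniteDimensional F S := ‹_›
  exact ⟨S, i1, i2, FiniteDimensional.complete F S, ⟨AlgEquiv.refl⟩⟩

end Norm

attribute [local instance] rankOneLocalInfty normedLocalInfty

variable {k K : Type*} [Field k] [Finite k] [Field K] [Algebra k[X] K] [Algebra (RatFunc k) K]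
  [IsScalarTower k[X] (RatFunc k) K]

lemma two_le_card : 2 ≤ Nat.card k := Finite.one_lt_card (α := k)

variable (k) in
/-- A ring homomorphism from `K` to a `k((t⁻¹))`-algebra is compatible if it restricts to the
structure map on `k(t)`. -/
def Compatible {A : Type*} [CommRing A] [Algebra (LocalInfty k) A] (ι : K →+* A) : Prop :=
  ∀ f : RatFunc k, ι (algebraMap (RatFunc k) K f) =
    algebraMap (LocalInfty k) A (algebraMap (RatFunc k) (LocalInfty k) f)

lemma Compatible.map_X {A : Type*} [CommRing A] [Algebra (LocalInfty k) A] {ι : K →+* A}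
    (h : Compatible k ι) :
    ι (algebraMap k[X] K Polynomial.X) = algebraMap (LocalInfty k) A tInfty := by
  rw [IsScalarTower.algebraMap_apply k[X] (RatFunc k) K, h, RatFunc.algebraMap_X]
  rfl

lemma add_pow_card_pow_of_ringHom {A : Type*} [CommRing A] (ι : K →+* A) (x y : A) (i : ℕ) :
    (x + y) ^ Nat.card k ^ i = x ^ Nat.card k ^ i + y ^ Nat.card k ^ i := by
  let _ : Algebra k[X] A := (ι.comp (algebraMap k[X] K)).toAlgebra
  exact add_pow_card_pow k x y i

lemma norm_tInfty_pow_sub {m : ℕ} (hm : 2 ≤ m) :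
    ‖(tInfty : LocalInfty k) ^ m - tInfty‖ = ‖(tInfty : LocalInfty k)‖ ^ m := by
  have h1 := one_lt_norm_tInfty (k := k)
  have h2 : ‖(-tInfty : LocalInfty k)‖ < ‖(tInfty : LocalInfty k) ^ m‖ := by
    rw [norm_neg, norm_pow]
    exact lt_self_pow₀ h1 (by omega)
  rw [sub_eq_add_neg, IsUltrametricDist.norm_add_eq_max_of_norm_ne_norm h2.ne', max_eq_left h2.le,
    norm_pow]

/-- The exponential is entire on every normed `K_∞`-algebra. -/
lemma summable_norm_expCoeff {A : Type*} [NormedCommRing A] [NormedAlgebra (LocalInfty k) A]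
    {ι : K →+* A} (hι : Compatible k ι) (E : DrinfeldModule k (ringOfIntegers k K)) {r : ℝ}
    (hr : 0 ≤ r) : Summable fun i => ‖ι (E.expCoeff K i)‖ * r ^ Nat.card k ^ i := by
  set q := Nat.card k with hq
  have hq2 : 2 ≤ q := two_le_card
  let a : ℕ → A := fun i => ι (algebraMap (ringOfIntegers k K) K (E.coeff i))
  obtain ⟨M, s, hM, hs, hs1, h⟩ := exists_decay hq2 (n := E.rank)
    (one_lt_norm_tInfty (k := k)) (u := fun i => ‖ι (E.expCoeff K i)‖) (a := fun i => ‖a i‖)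
    (fun i => norm_nonneg _) (fun i => norm_nonneg _)
    (fun i hi => by simp [a, E.coeff_eq_zero i hi]) fun i => by
      have h1 : 2 ≤ q ^ (i + 1) := hq2.trans (Nat.le_self_pow (Nat.succ_ne_zero i) q)
      have h2 : ι (E.expCoeff K (i + 1)) = ((tInfty : LocalInfty k) ^ q ^ (i + 1) - tInfty)⁻¹ •
          ∑ j ∈ Finset.range (i + 1), a (i + 1 - j) * ι (E.expCoeff K j) ^ q ^ (i + 1 - j) := by
        have e1 : (algebraMap k[X] K Polynomial.X ^ q ^ (i + 1) - algebraMap k[X] K Polynomial.X)⁻¹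
            = algebraMap (RatFunc k) K (RatFunc.X ^ q ^ (i + 1) - RatFunc.X)⁻¹ := by
          rw [map_inv₀, map_sub, map_pow, IsScalarTower.algebraMap_apply k[X] (RatFunc k) K,
            RatFunc.algebraMap_X]
        rw [DrinfeldModule.expCoeff, div_eq_inv_mul, e1, map_mul, hι, map_inv₀, map_sub, map_pow,
          Algebra.smul_def, Finset.sum_range, map_sum]
        simp only [map_mul, map_pow]
        rfl
      rw [h2, norm_smul, norm_inv, norm_tInfty_pow_sub h1]
      gcongr
      refine norm_sum_le_of_le _ fun j hj => (norm_mul_le _ _).trans ?_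
      gcongr
      exact norm_pow_le' _ (pow_pos (by omega) _)
  exact summable_of_decay hq2 hM hs hs1 (fun i => norm_nonneg _) h hr

lemma exists_finite_subalgebra [FiniteDimensional (RatFunc k) K] {B : Type*} [CommRing B]
    [Algebra (LocalInfty k) B] [Algebra.IsIntegral (LocalInfty k) B] {ι : K →+* B}
    (hι : Compatible k ι) (x : B) :
    ∃ S : Subalgebra (LocalInfty k) B, Module.Finite (LocalInfty k) S ∧ x ∈ S ∧ ∀ a, ι a ∈ S := by
  let b := Module.finBasis (RatFunc k) K
  let s : Set B := insert x (Set.range fun i => ι (b i))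
  have hs : s.Finite := (Set.finite_range _).insert x
  refine ⟨Algebra.adjoin (LocalInfty k) s, Algebra.finite_adjoin_of_finite_of_isIntegral hs
    fun y _ => Algebra.IsIntegral.isIntegral y, Algebra.subset_adjoin (Set.mem_insert _ _),
    fun a => ?_⟩
  rw [← b.sum_repr a, map_sum]
  refine Subalgebra.sum_mem _ fun i _ => ?_
  rw [Algebra.smul_def, map_mul, hι]
  exact Subalgebra.mul_mem _ (Subalgebra.algebraMap_mem _ _)
    (Algebra.subset_adjoin (Set.mem_insert_of_mem _ ⟨i, rfl⟩))

/-- The exponential converges everywhere on an integral `k((t⁻¹))`-algebra containing `K`. -/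
lemma summable_exp [FiniteDimensional (RatFunc k) K] {B : Type*} [CommRing B]
    [Algebra (LocalInfty k) B] [Algebra.IsIntegral (LocalInfty k) B] [TopologicalSpace B]
    [ContinuousAdd B] [ContinuousSMul (LocalInfty k) B] {ι : K →+* B}
    (hι : Compatible k ι) (E : DrinfeldModule k (ringOfIntegers k K)) (x : B) :
    Summable fun i => ι (E.expCoeff K i) * x ^ Nat.card k ^ i := by
  obtain ⟨S, hS, hx, hK⟩ := exists_finite_subalgebra hι x
  obtain ⟨A, _, _, _, ⟨e⟩⟩ := exists_normed_model (LocalInfty k) (S := S)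
  let ιA : K →+* A := (e : S →+* A).comp (ι.codRestrict S hK)
  have hιA : Compatible k ιA := fun f => by
    rw [← e.commutes]
    exact congrArg e (Subtype.ext (hι f))
  have : FiniteDimensional (LocalInfty k) A := Module.Finite.equiv e.toLinearEquiv
  let j : A →ₐ[LocalInfty k] B := S.val.comp e.symm
  have hj : Continuous j := by
    have : IsModuleTopology (LocalInfty k) A := isModuleTopologyOfFiniteDimensional
    exact IsModuleTopology.continuous_of_linearMap j.toLinearMap
  have hs : Summable fun i => ιA (E.expCoeff K i) * e ⟨x, hx⟩ ^ Nat.card k ^ i := by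
    refine Summable.of_norm_bounded
      (summable_norm_expCoeff hιA E (norm_nonneg (e ⟨x, hx⟩))) fun i => ?_
    refine (norm_mul_le _ _).trans ?_
    gcongr
    exact norm_pow_le' _ (pow_pos (Nat.card_pos (α := k)) _)
  convert hs.map j hj using 2 with i
  simp [j, ιA]

end Model

/-! ### The exponential on `K ⊗ L` -/

section ExtFacts

open FunctionField

attribute [local instance] rankOneLocalInfty normedLocalInfty

variable {k K L : Type*} [Field k] [Finite k] [Field K] [Algebra k[X] K] [Algebra (RatFunc k) K]
  [IsScalarTower k[X] (RatFunc k) K] [Field L] [Algebra (RatFunc k) L]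
  [Algebra (LocalInfty k) L] [IsScalarTower (RatFunc k) (LocalInfty k) L]

lemma compatible_algebraMap : Compatible k (algebraMap K (Ext k K L)) := fun f => by
  change (1 : L) ⊗ₜ[RatFunc k] (algebraMap (RatFunc k) K f) =
    (algebraMap (LocalInfty k) L (algebraMap (RatFunc k) (LocalInfty k) f)) ⊗ₜ[RatFunc k] (1 : K)
  rw [← IsScalarTower.algebraMap_apply, Algebra.algebraMap_eq_smul_one,
    Algebra.algebraMap_eq_smul_one, TensorProduct.smul_tmul]

instance [FiniteDimensional (RatFunc k) K] [Algebra.IsAlgebraic (LocalInfty k) L] :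
    Algebra.IsIntegral (LocalInfty k) (Ext k K L) := by
  let _ : Algebra L (Ext k K L) := inferInstanceAs (Algebra L (L ⊗[RatFunc k] K))
  have : IsScalarTower (LocalInfty k) L (Ext k K L) :=
    inferInstanceAs (IsScalarTower (LocalInfty k) L (L ⊗[RatFunc k] K))
  have : Module.Finite L (Ext k K L) := inferInstanceAs (Module.Finite L (L ⊗[RatFunc k] K))
  have : Algebra.IsIntegral (LocalInfty k) L := Algebra.IsAlgebraic.isIntegral
  exact Algebra.IsIntegral.trans L

instance : IsTopologicalAddGroup (Ext k K L) :=
  IsModuleTopology.topologicalAddGroup (LocalInfty k) _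

/-- Points of `K ⊗ L` are separated by linear forms, which are continuous. -/
instance : T2Space (Ext k K L) := by
  refine ⟨fun x y hxy => ?_⟩
  obtain ⟨f, hf⟩ : ∃ f : Module.Dual (LocalInfty k) (Ext k K L), f (x - y) ≠ 0 := by
    by_contra! h
    exact sub_ne_zero.mpr hxy ((Module.forall_dual_apply_eq_zero_iff (LocalInfty k) (x - y)).mp h)
  rw [map_sub, sub_ne_zero] at hf
  exact separated_by_continuous (IsModuleTopology.continuous_of_linearMap f) hf

lemma existsUnique_expEq [FiniteDimensional (RatFunc k) K] [Algebra.IsAlgebraic (LocalInfty k) L]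
    (E : DrinfeldModule k (ringOfIntegers k K)) (x : Ext k K L) :
    ∃! y : E.Points (Ext k K L), E.ExpEq K x y := by
  obtain ⟨y, hy⟩ := summable_exp (compatible_algebraMap (k := k) (K := K) (L := L)) E x
  exact ⟨E.toPoints _ y, hy, fun z hz =>
    (E.toPoints _).symm.injective (HasSum.unique hz hy)⟩

end ExtFacts

/-! ### Surjectivity of the exponential -/

section Roots

lemma norm_multiset_sum_lt {M α : Type*} [NormedField M] [IsUltrametricDist M] (s : Multiset α)
    (f : α → M) {c : ℝ} (hc : 0 < c) (h : ∀ a ∈ s, ‖f a‖ < c) : ‖(s.map f).sum‖ < c := by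
  induction s using Multiset.induction with
  | empty => simpa
  | cons a s ih =>
    rw [Multiset.map_cons, Multiset.sum_cons]
    exact (IsUltrametricDist.norm_add_le_max _ _).trans_lt (max_lt
      (h a (Multiset.mem_cons_self a s)) (ih fun b hb => h b (Multiset.mem_cons_of_mem hb)))

variable {M : Type*} [NormedField M] [IsUltrametricDist M] [IsSepClosed M] {q : ℕ}

/-- The equation `∑ aᵢ z^(qⁱ) = y` with `a₀ ≠ 0` has a root with `‖z‖ ≤ ‖y‖ / ‖a₀‖`: the sum of the
inverses of the roots is `a₀ / y`, so that one of these inverses has absolute value at least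
`‖a₀ / y‖`. -/
lemma exists_small_root (hq : 2 ≤ q) (hqM : (q : M) = 0) {a : ℕ → M} (n : ℕ) (ha : a 0 ≠ 0)
    (y : M) : ∃ z, ∑ i ∈ Finset.range (n + 1), a i * z ^ q ^ i = y ∧ ‖z‖ ≤ ‖y‖ / ‖a 0‖ := by
  by_cases hy : y = 0
  · refine ⟨0, ?_, by simp [hy]⟩
    rw [hy]
    exact Finset.sum_eq_zero fun i _ => by rw [zero_pow (pow_ne_zero i (by omega)), mul_zero]
  let P : M[X] := ∑ i ∈ Finset.range (n + 1), Polynomial.C (a i) * Polynomial.X ^ q ^ i -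
    Polynomial.C y
  have hPev : ∀ z, P.eval z = ∑ i ∈ Finset.range (n + 1), a i * z ^ q ^ i - y := fun z => by
    simp [P, Polynomial.eval_finsetSum]
  have hP0 : P.eval 0 = -y := by
    rw [hPev, Finset.sum_eq_zero, zero_sub]
    exact fun i _ => by rw [zero_pow (pow_ne_zero i (by omega)), mul_zero]
  have hder : Polynomial.derivative P = Polynomial.C (a 0) := by
    simp only [P, Polynomial.derivative_sub, Polynomial.derivative_sum, Polynomial.derivative_C,
      Polynomial.derivative_C_mul_X_pow, sub_zero]
    rw [Finset.sum_range_succ', Finset.sum_eq_zero, zero_add]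
    · simp
    · intro i _
      simp [hqM]
  have hsplit : P.Splits := by
    refine IsSepClosed.splits_of_separable P ?_
    rw [Polynomial.Separable, hder]
    exact ⟨0, Polynomial.C (a 0)⁻¹, by
      rw [zero_mul, zero_add, ← map_mul, inv_mul_cancel₀ ha, map_one]⟩
  have hsum := hsplit.eval_derivative_div_eval_of_ne_zero (x := 0) (by rwa [hP0, neg_ne_zero])
  rw [hder, Polynomial.eval_C, hP0] at hsum
  have hc : 0 < ‖a 0‖ / ‖y‖ := by positivity
  obtain ⟨z, hz, hzn⟩ : ∃ z ∈ P.roots, ‖a 0‖ / ‖y‖ ≤ ‖1 / (0 - z)‖ := by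
    by_contra! h
    have := norm_multiset_sum_lt _ _ hc h
    rw [← hsum, norm_div, norm_neg] at this
    exact lt_irrefl _ this
  refine ⟨z, ?_, ?_⟩
  · have := (Polynomial.mem_roots'.mp hz).2
    rwa [Polynomial.IsRoot, hPev, sub_eq_zero] at this
  · rw [zero_sub, norm_div, norm_neg, norm_one, one_div] at hzn
    have := inv_anti₀ hc hzn
    rwa [inv_inv, inv_div] at this

/-- Divided by a sufficiently high power of `φ(t)`, every point becomes arbitrarily small. -/
lemma exists_iterate_small (hq : 2 ≤ q) (hqM : (q : M) = 0) {a : ℕ → M} (n : ℕ) (ha : 1 < ‖a 0‖)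
    (y : M) {r : ℝ} (hr : 0 < r) :
    ∃ N z, (fun z => ∑ i ∈ Finset.range (n + 1), a i * z ^ q ^ i)^[N] z = y ∧ ‖z‖ < r := by
  have ha0 : a 0 ≠ 0 := by
    intro h
    rw [h, norm_zero] at ha
    linarith
  have key : ∀ N, ∃ z, (fun z => ∑ i ∈ Finset.range (n + 1), a i * z ^ q ^ i)^[N] z = y ∧
      ‖z‖ ≤ ‖y‖ / ‖a 0‖ ^ N := by
    intro N
    induction N with
    | zero => exact ⟨y, rfl, by simp⟩
    | succ N ih =>
      obtain ⟨z, hz, hzn⟩ := ih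
      obtain ⟨w, hw, hwn⟩ := exists_small_root hq hqM n ha0 z
      refine ⟨w, by rw [Function.iterate_succ_apply, hw, hz], hwn.trans ?_⟩
      rw [pow_succ, ← div_div]
      gcongr
  obtain ⟨N, hN⟩ := pow_unbounded_of_one_lt (‖y‖ / r) ha
  obtain ⟨z, hz, hzn⟩ := key N
  refine ⟨N, z, hz, hzn.trans_lt ?_⟩
  rw [div_lt_iff₀ hr] at hN
  rw [div_lt_iff₀ (by positivity)]
  linarith

end Roots

section Surjective

open FunctionField

attribute [local instance] rankOneLocalInfty normedLocalInfty

variable {k K : Type*} [Field k] [Finite k] [Field K] [Algebra k[X] K] [Algebra (RatFunc k) K]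
  [IsScalarTower k[X] (RatFunc k) K] [FiniteDimensional (RatFunc k) K]

omit [FiniteDimensional (RatFunc k) K] in
lemma natCast_card_eq_zero {M : Type*} [CommRing M] (ι : K →+* M) : (Nat.card k : M) = 0 := by
  have := Fintype.ofFinite k
  have h : (Nat.card k : k) = 0 := by
    rw [Nat.card_eq_fintype_card]
    exact FiniteField.cast_card_eq_zero k
  have := congrArg ((ι.comp (algebraMap k[X] K)).comp Polynomial.C) h
  rwa [map_natCast, map_zero] at this

/-- Over a separably closed algebraic extension of `k((t⁻¹))`, every point becomes a value of the
exponential after division by a power of `φ(t)`. -/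
lemma exists_hasSum_iterate {M : Type*} [NormedField M] [NormedAlgebra (LocalInfty k) M]
    [IsUltrametricDist M] [IsSepClosed M] [Algebra.IsAlgebraic (LocalInfty k) M] {ι : K →+* M}
    (hι : Compatible k ι) (E : DrinfeldModule k (ringOfIntegers k K)) (y : M) :
    ∃ (N : ℕ) (x z : M), (fun z => ∑ i ∈ Finset.range (E.rank + 1),
      ι (algebraMap (ringOfIntegers k K) K (E.coeff i)) * z ^ Nat.card k ^ i)^[N] z = y ∧
      HasSum (fun i => ι (E.expCoeff K i) * x ^ Nat.card k ^ i) z := by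
  have ha : 1 < ‖ι (algebraMap (ringOfIntegers k K) K (E.coeff 0))‖ := by
    rw [E.coeff_zero, ← IsScalarTower.algebraMap_apply, hι.map_X, norm_algebraMap']
    exact one_lt_norm_tInfty
  obtain ⟨r, hr, hr1, hrS⟩ := exists_radius (∑' i, ‖ι (E.expCoeff K (i + 1))‖)
  obtain ⟨N, z, hz, hzr⟩ := exists_iterate_small (a := fun i =>
    ι (algebraMap (ringOfIntegers k K) K (E.coeff i))) (two_le_card (k := k))
    (natCast_card_eq_zero ι) E.rank ha y hr
  -- the equation `exp x = z` is solved in a finite subextension, which is complete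
  have : Algebra.IsIntegral (LocalInfty k) M := Algebra.IsAlgebraic.isIntegral
  obtain ⟨S, hS, hzS, hK⟩ := exists_finite_subalgebra hι z
  let ιS : K →+* S := ι.codRestrict S hK
  have : FiniteDimensional (LocalInfty k) S := hS
  have : CompleteSpace S := FiniteDimensional.complete (LocalInfty k) S
  have hιS : Compatible k ιS := fun f => Subtype.ext (hι f)
  have he0 : ιS (E.expCoeff K 0) = 1 := by
    rw [DrinfeldModule.expCoeff, map_one]
  obtain ⟨x, -, hx⟩ := (exists_local_inverse_of_radius (two_le_card (k := k))
    (add_pow_card_pow_of_ringHom ιS) (e := fun i => ιS (E.expCoeff K i)) he0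
    (fun r hr => summable_norm_expCoeff hιS E hr) hr hr1 hrS).2 ⟨z, hzS⟩ hzr
  exact ⟨N, x, z, hz, hx.map S.val continuous_subtype_val⟩

variable {Ω : Type*} [Field Ω] [Algebra (RatFunc k) Ω] [Algebra (LocalInfty k) Ω]
  [IsScalarTower (RatFunc k) (LocalInfty k) Ω]

/-- Every `k((t⁻¹))`-subspace of `K ⊗ Ω` is closed, being an intersection of kernels of linear
forms. -/
lemma hasSum_mem (S : Submodule (LocalInfty k) (Ext k K Ω)) {f : ℕ → Ext k K Ω} {s : Ext k K Ω}
    (h : HasSum f s) (hf : ∀ i, f i ∈ S) : s ∈ S := by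
  by_contra hs
  obtain ⟨g, hg, hgS⟩ := Submodule.exists_le_ker_of_notMem hs
  refine hg ?_
  have h1 := h.map g (IsModuleTopology.continuous_of_linearMap g)
  have h2 : g ∘ f = 0 := funext fun i => hgS (hf i)
  rw [h2] at h1
  exact h1.unique hasSum_zero

variable [IsSepClosure (LocalInfty k) Ω]

omit [FiniteDimensional (RatFunc k) K] [IsScalarTower k[X] (RatFunc k) K] in
lemma isAlgebraic_of_isSepClosure : Algebra.IsAlgebraic (LocalInfty k) Ω :=
  have := IsSepClosure.separable (k := LocalInfty k) (K := Ω)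
  inferInstance

lemma exists_expEq_map_eq (E : DrinfeldModule k (ringOfIntegers k K)) {M : Type*} [Field M]
    [Algebra (LocalInfty k) M] {π : Ext k K Ω →ₐ[LocalInfty k] M} (hπ : Function.Surjective π)
    (y : Ext k K Ω) : ∃ x z : Ext k K Ω, E.ExpEq K x (E.toPoints _ z) ∧ π z = π y := by
  have := isAlgebraic_of_isSepClosure (k := k) (Ω := Ω)
  let _ : Algebra Ω (Ext k K Ω) := inferInstanceAs (Algebra Ω (Ω ⊗[RatFunc k] K))
  have : IsScalarTower (LocalInfty k) Ω (Ext k K Ω) :=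
    inferInstanceAs (IsScalarTower (LocalInfty k) Ω (Ω ⊗[RatFunc k] K))
  let _ : Algebra Ω M := ((π : Ext k K Ω →+* M).comp (algebraMap Ω (Ext k K Ω))).toAlgebra
  have : IsScalarTower (LocalInfty k) Ω M := IsScalarTower.of_algebraMap_eq fun c => by
    change _ = π (algebraMap Ω (Ext k K Ω) (algebraMap (LocalInfty k) Ω c))
    rw [← IsScalarTower.algebraMap_apply, AlgHom.commutes]
  have : Algebra.IsAlgebraic (LocalInfty k) M := ⟨fun m => by
    obtain ⟨b, rfl⟩ := hπ m
    exact ((Algebra.IsIntegral.isIntegral (R := LocalInfty k) b).map π).isAlgebraic⟩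
  have : Algebra.IsAlgebraic Ω M := Algebra.IsAlgebraic.tower_top (K := LocalInfty k) Ω
  have : IsSepClosed Ω := IsSepClosure.sep_closed (LocalInfty k)
  have : IsSepClosed M := Algebra.IsAlgebraic.isSepClosed (F := Ω)
  let _ : NormedField M := spectralNorm.normedField (LocalInfty k) M
  let _ : NormedAlgebra (LocalInfty k) M := spectralNorm.normedAlgebra (LocalInfty k) M
  have : IsUltrametricDist M :=
    IsUltrametricDist.isUltrametricDist_of_isNonarchimedean_norm isNonarchimedean_spectralNorm
  let ι : K →+* M := (π : Ext k K Ω →+* M).comp (algebraMap K (Ext k K Ω))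
  have hι : Compatible k ι := fun f => by
    change π (algebraMap K (Ext k K Ω) _) = _
    rw [compatible_algebraMap, AlgHom.commutes]
  obtain ⟨N, x, z, hz, hx⟩ := exists_hasSum_iterate hι E (π y)
  obtain ⟨x, rfl⟩ := hπ x
  obtain ⟨w, hw, -⟩ := existsUnique_expEq E x
  obtain ⟨w, rfl⟩ := (E.toPoints _).surjective w
  have hcont : Continuous π := IsModuleTopology.continuous_of_linearMap π.toLinearMap
  have hwz : π w = z := by
    refine HasSum.unique ?_ hx
    convert HasSum.map (show HasSum _ w from hw) π hcont using 2 with i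
    simp [ι]
  have hφ : ∀ N, π ((E.phiT (Ext k K Ω))^[N] w) =
      (fun z => ∑ i ∈ Finset.range (E.rank + 1),
        ι (algebraMap (ringOfIntegers k K) K (E.coeff i)) * z ^ Nat.card k ^ i)^[N] z := by
    intro N
    induction N with
    | zero => exact hwz
    | succ N ih =>
      rw [Function.iterate_succ_apply', Function.iterate_succ_apply', ← ih, E.phiT_apply, map_sum]
      refine Finset.sum_congr rfl fun i _ => ?_
      rw [map_mul, map_pow]
      rfl
  have hX : ∀ N, E.ExpEq K ((Polynomial.X ^ N : k[X]) • x)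
      (E.toPoints _ ((E.phiT (Ext k K Ω))^[N] w)) := by
    intro N
    induction N with
    | zero => simpa using hw
    | succ N ih =>
      rw [pow_succ', mul_smul, Function.iterate_succ_apply']
      have := ih.X_smul
      rwa [DrinfeldModule.smul_toPoints, DrinfeldModule.phi_X] at this
  exact ⟨_, _, hX N, by rw [hφ, hz]⟩

/-- The exponential maps the nilradical onto itself, since `exp z ∈ z + z ^ q B`. -/
lemma exists_expEq_of_pow_eq_zero (E : DrinfeldModule k (ringOfIntegers k K)) (s : ℕ)
    (z : Ext k K Ω) (hz : z ^ Nat.card k ^ s = 0) : ∃ x, E.ExpEq K x (E.toPoints _ z) := by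
  have := isAlgebraic_of_isSepClosure (k := k) (Ω := Ω)
  induction s generalizing z with
  | zero =>
    rw [pow_zero, pow_one] at hz
    exact ⟨0, by rw [hz, map_zero]; exact DrinfeldModule.ExpEq.zero⟩
  | succ s ih =>
    obtain ⟨w, hw, -⟩ := existsUnique_expEq E z
    obtain ⟨w, rfl⟩ := (E.toPoints _).surjective w
    have h1 : w - z ∈ (Ideal.span {z ^ Nat.card k}).restrictScalars (LocalInfty k) := by
      have h2 := (hasSum_nat_add_iff' 1).mpr hw
      rw [Finset.sum_range_one, AddEquiv.symm_apply_apply, DrinfeldModule.expCoeff, map_one,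
        one_mul, pow_zero, pow_one] at h2
      refine hasSum_mem _ h2 fun i => ?_
      refine Ideal.mul_mem_left _ _ (Ideal.mem_span_singleton.mpr (pow_dvd_pow z ?_))
      exact Nat.le_self_pow (Nat.succ_ne_zero i) _
    obtain ⟨h, hh⟩ := Ideal.mem_span_singleton.mp h1
    obtain ⟨x, hx⟩ := ih (z - w) (by
      rw [← neg_sub w z, hh, ← mul_neg, mul_pow, ← pow_mul, ← pow_succ', hz, zero_mul])
    refine ⟨z + x, ?_⟩
    have := hw.add hx
    rwa [← map_add, add_sub_cancel] at this

theorem exists_expEq (E : DrinfeldModule k (ringOfIntegers k K)) (y : E.Points (Ext k K Ω)) :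
    ∃ x : Ext k K Ω, E.ExpEq K x y := by
  obtain ⟨y, rfl⟩ := (E.toPoints _).surjective y
  have := isAlgebraic_of_isSepClosure (k := k) (Ω := Ω)
  have : IsArtinianRing (Ext k K Ω) := by
    let _ : Algebra Ω (Ext k K Ω) := inferInstanceAs (Algebra Ω (Ω ⊗[RatFunc k] K))
    have : Module.Finite Ω (Ext k K Ω) := inferInstanceAs (Module.Finite Ω (Ω ⊗[RatFunc k] K))
    exact IsArtinianRing.of_finite Ω _
  have hm : ∀ m : MaximalSpectrum (Ext k K Ω), ∃ x z : Ext k K Ω,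
      E.ExpEq K x (E.toPoints _ z) ∧ z - y ∈ m.asIdeal := by
    intro m
    have := m.isMaximal
    let _ := Ideal.Quotient.field m.asIdeal
    obtain ⟨x, z, hx, hz⟩ := exists_expEq_map_eq E
      (π := Ideal.Quotient.mkₐ (LocalInfty k) m.asIdeal) (Ideal.Quotient.mkₐ_surjective _ _) y
    exact ⟨x, z, hx, Ideal.Quotient.eq.mp hz⟩
  choose x z hx hz using hm
  obtain ⟨x', hx'⟩ := Ideal.pi_quotient_surjective
    (I := fun m : MaximalSpectrum (Ext k K Ω) => m.asIdeal)
    (fun m n hmn => Ideal.isCoprime_of_isMaximal fun h => hmn (MaximalSpectrum.ext h))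
    (fun m => Ideal.Quotient.mk _ (x m))
  obtain ⟨w, hw, -⟩ := existsUnique_expEq E x'
  obtain ⟨w, rfl⟩ := (E.toPoints _).surjective w
  have hwz : ∀ m : MaximalSpectrum (Ext k K Ω), w - z m ∈ m.asIdeal := by
    intro m
    refine hasSum_mem (m.asIdeal.restrictScalars (LocalInfty k)) (HasSum.sub hw (hx m)) fun i => ?_
    rw [← mul_sub]
    refine Ideal.mul_mem_left _ _ (Ideal.Quotient.eq.mp ?_)
    rw [map_pow, map_pow, hx']
  have hnil : IsNilpotent (y - w) := by
    rw [← mem_nilradical, nilradical_eq_sInf, Ideal.mem_sInf]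
    intro I (hI : I.IsPrime)
    have hmax := IsArtinianRing.isMaximal_of_isPrime I
    have := I.sub_mem (I.neg_mem (hwz ⟨I, hmax⟩)) (hz ⟨I, hmax⟩)
    convert this using 1
    ring
  obtain ⟨n, hn⟩ := hnil
  obtain ⟨v, hv⟩ := exists_expEq_of_pow_eq_zero E n (y - w)
    (pow_eq_zero_of_le (Nat.lt_pow_self (two_le_card (k := k))).le hn)
  refine ⟨x' + v, ?_⟩
  have := hw.add hv
  rwa [← map_add, add_sub_cancel] at this

end Surjective

/-! ### The ring of integers is discrete and cocompact in `K_∞` -/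

section Integers

open FunctionField Filter Topology

attribute [local instance] rankOneLocalInfty normedLocalInfty

variable {k K : Type*} [Field k] [Field K] [Algebra k[X] K] [Algebra (RatFunc k) K]
  [IsScalarTower k[X] (RatFunc k) K]

/-- A basis of `K` over `k(t)` as a basis of `K_∞` over `k((t⁻¹))`. -/
def extBasis {ι : Type*} (b : Module.Basis ι (RatFunc k) K) :
    Module.Basis ι (LocalInfty k) (KInfty k K) :=
  Algebra.TensorProduct.basis (LocalInfty k) b

lemma extBasis_apply {ι : Type*} (b : Module.Basis ι (RatFunc k) K) (i : ι) :
    extBasis b i = algebraMap K (KInfty k K) (b i) :=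
  Algebra.TensorProduct.basis_apply b i

lemma extBasis_repr_algebraMap {ι : Type*} (b : Module.Basis ι (RatFunc k) K) (a : K) (i : ι) :
    (extBasis b).repr (algebraMap K (KInfty k K) a) i =
      algebraMap (RatFunc k) (LocalInfty k) (b.repr a i) := by
  have h := DFunLike.congr_fun
    (Algebra.TensorProduct.basis_repr_tmul (A := LocalInfty k) b 1 a) i
  rw [one_smul] at h
  exact h

/-- The `k[t]`-submodule of the vectors all of whose coordinates have denominator dividing `D`. -/
def boundedDenominators {ι : Type*} (b : Module.Basis ι (RatFunc k) K) (D : k[X]) :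
    Submodule k[X] K where
  carrier := {a | ∀ i, ∃ p : k[X], algebraMap k[X] (RatFunc k) D * b.repr a i =
    algebraMap k[X] (RatFunc k) p}
  zero_mem' i := ⟨0, by simp⟩
  add_mem' {x y} hx hy i := by
    obtain ⟨p, hp⟩ := hx i
    obtain ⟨p', hp'⟩ := hy i
    exact ⟨p + p', by rw [map_add, Finsupp.add_apply, mul_add, hp, hp', map_add]⟩
  smul_mem' c x hx i := by
    obtain ⟨p, hp⟩ := hx i
    refine ⟨c * p, ?_⟩
    rw [← algebraMap_smul (RatFunc k) c x, map_smul, Finsupp.smul_apply, smul_eq_mul,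
      mul_left_comm, hp, map_mul]

/-- The powers of an integral element have a common denominator with respect to any basis. -/
lemma exists_common_denominator {ι : Type*} [Finite ι] (b : Module.Basis ι (RatFunc k) K) {r : K}
    (hr : IsIntegral k[X] r) : ∃ D : k[X], D ≠ 0 ∧ ∀ n : ℕ, r ^ n ∈ boundedDenominators b D := by
  classical
  have := Fintype.ofFinite ι
  obtain ⟨s, hs⟩ := hr.fg_adjoin_singleton
  obtain ⟨D, hD⟩ := IsLocalization.exist_integer_multiples_of_finset (nonZeroDivisors k[X])
    ((s ×ˢ Finset.univ).image fun a : K × ι => b.repr a.1 a.2)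
  refine ⟨D, nonZeroDivisors.ne_zero D.2, fun n => ?_⟩
  have h1 : Submodule.span k[X] (s : Set K) ≤ boundedDenominators b D := by
    refine Submodule.span_le.mpr fun a ha i => ?_
    obtain ⟨p, hp⟩ := hD (b.repr a i) (Finset.mem_image.mpr
      ⟨(a, i), Finset.mem_product.mpr ⟨ha, Finset.mem_univ i⟩, rfl⟩)
    exact ⟨p, by rw [hp, Algebra.smul_def]⟩
  refine h1 ?_
  rw [hs]
  exact Subalgebra.pow_mem _ (Algebra.self_mem_adjoin_singleton _ _) n

variable [FiniteDimensional (RatFunc k) K]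

/-- The ring of integers is discrete in `K_∞`: an element `r` near `0` is topologically nilpotent,
and the powers of `r` have a common denominator, so that they vanish eventually. -/
lemma exists_nhds_zero_integers : ∃ U ∈ 𝓝 (0 : KInfty k K), ∀ r : ringOfIntegers k K,
    algebraMap (ringOfIntegers k K) (KInfty k K) r ∈ U → r = 0 := by
  let b := Module.finBasis (RatFunc k) K
  have hfin : FiniteDimensional (LocalInfty k) (KInfty k K) := Module.Finite.of_basis (extBasis b)
  obtain ⟨A, _, _, _, ⟨e⟩⟩ := exists_normed_model (LocalInfty k) (S := KInfty k K)
  have : FiniteDimensional (LocalInfty k) A := Module.Finite.equiv e.toLinearEquiv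
  have : IsModuleTopology (LocalInfty k) A := isModuleTopologyOfFiniteDimensional
  have he : Continuous e := IsModuleTopology.continuous_of_linearMap e.toLinearMap
  refine ⟨e ⁻¹' Metric.ball 0 1, he.continuousAt.preimage_mem_nhds (by
    rw [map_zero]; exact Metric.ball_mem_nhds 0 one_pos), fun r hr => ?_⟩
  have hr' : ‖e (algebraMap (ringOfIntegers k K) (KInfty k K) r)‖ < 1 := by simpa using hr
  obtain ⟨D, hD, hp⟩ := exists_common_denominator b (r := (r : K)) r.2
  choose p hp using hp
  have hlim := tendsto_pow_atTop_nhds_zero_of_norm_lt_one hr'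
  have hcoord : ∀ i, Tendsto (fun n => polyInfty (p n i)) atTop (𝓝 0) := by
    intro i
    let f : A →ₗ[LocalInfty k] LocalInfty k :=
      polyInfty D • ((extBasis b).coord i ∘ₗ e.symm.toLinearMap)
    have hf : Continuous f := IsModuleTopology.continuous_of_linearMap f
    have h1 := (hf.tendsto 0).comp hlim
    rw [map_zero] at h1
    refine h1.congr fun n => ?_
    have h2 : e.symm (e (algebraMap (ringOfIntegers k K) (KInfty k K) r) ^ n) =
        algebraMap K (KInfty k K) ((r : K) ^ n) := by
      rw [← map_pow, AlgEquiv.symm_apply_apply, map_pow]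
      rfl
    change polyInfty D * (extBasis b).repr (e.symm (_ ^ n)) i = _
    rw [h2, extBasis_repr_algebraMap, ← map_mul, hp]
  have hev : ∀ᶠ n in atTop, ∀ i, p n i = 0 := by
    refine eventually_all.mpr fun i => ?_
    filter_upwards [(hcoord i).eventually (Metric.ball_mem_nhds 0 one_pos)] with n hn
    by_contra h0
    replace hn : dist _ _ < 1 := hn
    rw [dist_zero_right] at hn
    exact absurd (one_le_norm_polyInfty h0) (not_le.mpr hn)
  obtain ⟨n, hn⟩ := hev.exists
  have h3 : (r : K) ^ n = 0 := by
    refine b.repr.map_eq_zero_iff.mp (Finsupp.ext fun i => ?_)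
    have := hp n i
    rw [hn i, map_zero, mul_eq_zero] at this
    exact this.resolve_left
      ((map_ne_zero_iff _ (IsFractionRing.injective k[X] (RatFunc k))).mpr hD)
  exact Subtype.ext (eq_zero_of_pow_eq_zero h3)

variable (k K) in
/-- The image of the ring of integers in `K_∞`. -/
def integersInfty : AddSubgroup (KInfty k K) :=
  (algebraMap (ringOfIntegers k K) (KInfty k K)).toAddMonoidHom.range

/-- The ring of integers is cocompact: `K_∞` is the sum of the polydisc of vectors with
coordinates in `k[[t⁻¹]]` and of a `k[t]`-lattice of integral elements. -/
instance [Finite k] : CompactSpace (KInfty k K ⧸ integersInfty k K) := by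
  classical
  obtain ⟨s, b, hb⟩ := FiniteDimensional.exists_is_basis_integral k[X] (RatFunc k) K
  let f : (s → LocalInfty k) →ₗ[LocalInfty k] KInfty k K := (extBasis b).equivFun.symm.toLinearMap
  have hf : Continuous f := IsModuleTopology.continuous_of_linearMap f
  have hC := (isCompact_univ_pi fun _ : s => isCompact_closedBall_localInfty (k := k)).image
    ((QuotientAddGroup.continuous_mk (N := integersInfty k K)).comp hf)
  refine ⟨?_⟩
  convert hC
  symm
  rw [Set.eq_univ_iff_forall]
  intro x
  obtain ⟨x, rfl⟩ := QuotientAddGroup.mk_surjective x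
  choose p hp using fun i => exists_polynomial_near ((extBasis b).equivFun x i)
  let c : s → LocalInfty k := fun i => (extBasis b).equivFun x i - polyInfty (p i)
  refine ⟨c, fun i _ => mem_closedBall_zero_iff.mpr (hp i).le, ?_⟩
  refine QuotientAddGroup.eq.mpr ?_
  let r : ringOfIntegers k K := ∑ i, p i • ⟨b i, hb i⟩
  refine ⟨r, ?_⟩
  have h1 : algebraMap (ringOfIntegers k K) (KInfty k K) r = f fun i => polyInfty (p i) := by
    change algebraMap K (KInfty k K) (r : K) = _
    have h2 : (r : K) = ∑ i, p i • b i := by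
      simp [r]
    rw [h2, map_sum]
    change _ = (extBasis b).equivFun.symm _
    rw [Module.Basis.equivFun_symm_apply]
    refine Finset.sum_congr rfl fun i _ => ?_
    rw [extBasis_apply, Algebra.smul_def, Algebra.smul_def, map_mul,
      IsScalarTower.algebraMap_apply k[X] (RatFunc k) K, compatible_algebraMap]
  have h3 : x = f ((extBasis b).equivFun x) := ((extBasis b).equivFun.symm_apply_apply x).symm
  change algebraMap (ringOfIntegers k K) (KInfty k K) r = _
  rw [h1]
  nth_rw 1 [h3]
  rw [← map_neg, ← map_add]
  congr 1
  ext i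
  simp [c]

end Integers

/-! ### The inverse image of the integers under the exponential -/

section Preimage

open FunctionField Filter Topology

/-- If `f : G → H` is continuous, open and additive, then `G / f⁻¹(N)` is an open and hence closed
subgroup of `H / N`. -/
lemma compactSpace_quotient_comap {G H : Type*} [AddCommGroup G] [TopologicalSpace G]
    [IsTopologicalAddGroup G] [AddCommGroup H] [TopologicalSpace H] [IsTopologicalAddGroup H]
    (f : G →+ H) (hf : Continuous f) (hfo : IsOpenMap f) (N : AddSubgroup H)
    [CompactSpace (H ⧸ N)] : CompactSpace (G ⧸ N.comap f) := by
  let ψ : G ⧸ N.comap f →+ H ⧸ N := QuotientAddGroup.map _ N f le_rfl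
  have hcomp : ψ ∘ QuotientAddGroup.mk = QuotientAddGroup.mk ∘ f := rfl
  have hcont : Continuous ψ := by
    rw [QuotientAddGroup.isOpenQuotientMap_mk.isQuotientMap.continuous_iff, hcomp]
    exact QuotientAddGroup.continuous_mk.comp hf
  have hinj : Function.Injective ψ := by
    rw [injective_iff_map_eq_zero]
    intro a ha
    obtain ⟨a, rfl⟩ := QuotientAddGroup.mk_surjective a
    rw [QuotientAddGroup.eq_zero_iff]
    exact (QuotientAddGroup.eq_zero_iff (f a)).mp ha
  have hopen : IsOpenMap ψ := IsOpenMap.of_comp QuotientAddGroup.continuous_mk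
    QuotientAddGroup.mk_surjective (hcomp ▸ QuotientAddGroup.isOpenMap_coe.comp hfo)
  have hemb := IsOpenEmbedding.of_continuous_injective_isOpenMap hcont hinj hopen
  exact (IsClosedEmbedding.mk hemb.isEmbedding
    (AddSubgroup.isClosed_of_isOpen ψ.range hemb.isOpen_range)).compactSpace

attribute [local instance] rankOneLocalInfty normedLocalInfty

variable {k K : Type*} [Field k] [Finite k] [Field K] [Algebra k[X] K] [Algebra (RatFunc k) K]
  [IsScalarTower k[X] (RatFunc k) K] [FiniteDimensional (RatFunc k) K]
  (E : DrinfeldModule k (ringOfIntegers k K))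

/-- The exponential as an endomorphism of the additive group of `K_∞`. -/
def expInfty : KInfty k K →+ KInfty k K where
  toFun x := (E.toPoints _).symm (existsUnique_expEq E x).choose
  map_zero' := (map_eq_zero_iff _ (E.toPoints _).symm.injective).mpr
    ((existsUnique_expEq E _).unique (existsUnique_expEq E _).choose_spec.1
      DrinfeldModule.ExpEq.zero)
  map_add' x y := by
    rw [← map_add]
    exact congrArg _ ((existsUnique_expEq E _).unique (existsUnique_expEq E _).choose_spec.1
      ((existsUnique_expEq E x).choose_spec.1.add (existsUnique_expEq E y).choose_spec.1))

lemma expEq_expInfty (x : KInfty k K) : E.ExpEq K x (E.toPoints _ (expInfty E x)) :=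
  (existsUnique_expEq E x).choose_spec.1

lemma expEq_iff (x y : KInfty k K) : E.ExpEq K x (E.toPoints _ y) ↔ expInfty E x = y := by
  constructor
  · exact fun h => (E.toPoints _).injective
      ((existsUnique_expEq E x).unique (expEq_expInfty E x) h)
  · rintro rfl
    exact expEq_expInfty E x

/-- The exponential of `K_∞` is a local isomorphism at `0`. -/
lemma expInfty_local : ContinuousAt (expInfty E) 0 ∧
    (∃ U ∈ 𝓝 (0 : KInfty k K), ∀ x ∈ U, expInfty E x = 0 → x = 0) ∧
    𝓝 0 ≤ map (expInfty E) (𝓝 0) := by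
  have : FiniteDimensional (LocalInfty k) (KInfty k K) :=
    Module.Finite.of_basis (extBasis (Module.finBasis (RatFunc k) K))
  obtain ⟨A, _, _, _, ⟨e⟩⟩ := exists_normed_model (LocalInfty k) (S := KInfty k K)
  have : FiniteDimensional (LocalInfty k) A := Module.Finite.equiv e.toLinearEquiv
  have : IsModuleTopology (LocalInfty k) A := isModuleTopologyOfFiniteDimensional
  have he : Continuous e := IsModuleTopology.continuous_of_linearMap e.toLinearMap
  have he' : Continuous e.symm := IsModuleTopology.continuous_of_linearMap e.symm.toLinearMap
  let ι : K →+* A := (e : KInfty k K →+* A).comp (algebraMap K (KInfty k K))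
  have hι : Compatible k ι := fun f => by
    change e (algebraMap K (KInfty k K) _) = _
    rw [compatible_algebraMap, AlgEquiv.commutes]
  have hexp : ∀ x, HasSum (fun i => ι (E.expCoeff K i) * e x ^ Nat.card k ^ i)
      (e (expInfty E x)) := fun x => by
    convert (show HasSum _ (expInfty E x) from expEq_expInfty E x).map e he using 2 with i
    simp [ι]
  obtain ⟨r, hr, h1, h2⟩ := exists_local_inverse (two_le_card (k := k))
    (add_pow_card_pow_of_ringHom ι) (e := fun i => ι (E.expCoeff K i))
    (by rw [DrinfeldModule.expCoeff, map_one]) (fun r hr => summable_norm_expCoeff hι E hr)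
  have hball : ∀ s, 0 < s → e ⁻¹' Metric.ball 0 s ∈ 𝓝 (0 : KInfty k K) := fun s hs =>
    he.continuousAt.preimage_mem_nhds (by rw [map_zero]; exact Metric.ball_mem_nhds 0 hs)
  have hnorm : Tendsto (fun x => ‖e x‖) (𝓝 (0 : KInfty k K)) (𝓝 0) := by
    have := (he.norm.tendsto (0 : KInfty k K))
    rwa [map_zero, norm_zero] at this
  refine ⟨?_, ⟨_, hball r hr, fun x hx hx0 => ?_⟩, ?_⟩
  · have h3 : Tendsto (fun x => e (expInfty E x)) (𝓝 0) (𝓝 0) := by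
      refine squeeze_zero_norm' (a := fun x => 2 * ‖e x‖) ?_ (by simpa using hnorm.const_mul 2)
      filter_upwards [hball r hr] with x hx
      exact (h1 (e x) _ (mem_ball_zero_iff.mp hx) (hexp x)).2
    have h4 := (he'.tendsto 0).comp h3
    rw [map_zero] at h4
    rw [ContinuousAt, map_zero]
    exact h4.congr fun x => e.symm_apply_apply _
  · have := (h1 (e x) _ (mem_ball_zero_iff.mp hx) (hexp x)).1
    rw [hx0, map_zero, norm_zero, mul_zero] at this
    exact (map_eq_zero_iff e e.injective).mp (norm_le_zero_iff.mp this)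
  · intro V hV
    have h3 : e.symm ⁻¹' (expInfty E ⁻¹' V) ∈ 𝓝 (0 : A) :=
      he'.continuousAt.preimage_mem_nhds (by rw [map_zero]; exact hV)
    obtain ⟨s, hs, hsV⟩ := Metric.mem_nhds_iff.mp h3
    refine mem_of_superset (hball (min r (s / 2)) (by positivity)) fun y hy => ?_
    have hy' : ‖e y‖ < min r (s / 2) := mem_ball_zero_iff.mp hy
    obtain ⟨x, hx, hxy⟩ := h2 (e y) (hy'.trans_le (min_le_left _ _))
    have h4 : x ∈ Metric.ball (0 : A) s := by
      rw [mem_ball_zero_iff]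
      linarith [min_le_right r (s / 2)]
    have h5 : expInfty E (e.symm x) = y := by
      refine e.injective (HasSum.unique (hexp (e.symm x)) ?_)
      rwa [e.apply_symm_apply]
    rw [← h5]
    exact hsV h4

lemma continuous_expInfty : Continuous (expInfty E) :=
  continuous_of_continuousAt_zero _ (expInfty_local E).1

lemma isOpenMap_expInfty : IsOpenMap (expInfty E) :=
  IsTopologicalAddGroup.isOpenMap_iff_nhds_zero.mpr (expInfty_local E).2.2

lemma mem_expPreimage {x : KInfty k K} :
    x ∈ E.expPreimage ↔ expInfty E x ∈ integersInfty k K := by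
  constructor
  · rintro ⟨r, hr⟩
    exact ⟨(E.toPoints _).symm r, ((expEq_iff E x _).mp hr).symm⟩
  · rintro ⟨r, hr⟩
    exact ⟨E.toPoints _ r, (expEq_iff E x _).mpr hr.symm⟩

theorem discreteTopology_expPreimage : DiscreteTopology E.expPreimage := by
  obtain ⟨U, hU, hUR⟩ := exists_nhds_zero_integers (k := k) (K := K)
  obtain ⟨-, ⟨V, hV, hV0⟩, -⟩ := expInfty_local E
  have hW : expInfty E ⁻¹' U ∩ V ∈ 𝓝 (0 : KInfty k K) :=
    inter_mem ((continuous_expInfty E).continuousAt.preimage_mem_nhds (by rwa [map_zero])) hV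
  refine discreteTopology_of_isOpen_singleton_zero ?_
  refine isOpen_iff_mem_nhds.mpr ?_
  rintro _ rfl
  refine mem_of_superset (continuous_subtype_val.continuousAt.preimage_mem_nhds
    (x := (0 : E.expPreimage)) hW) fun x hx => ?_
  obtain ⟨r, hr⟩ := (mem_expPreimage E).mp x.2
  have hr0 : r = 0 := hUR r (by
    change algebraMap _ _ r = _ at hr
    rw [hr]
    exact hx.1)
  refine Subtype.ext (hV0 _ hx.2 ?_)
  rw [← hr, hr0, map_zero]

theorem compactSpace_quotient_expPreimage : CompactSpace (KInfty k K ⧸ E.expPreimage) := by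
  have h1 : E.expPreimage.toAddSubgroup = (integersInfty k K).comap (expInfty E) :=
    AddSubgroup.ext fun x => mem_expPreimage E
  have h2 : CompactSpace (KInfty k K ⧸ E.expPreimage.toAddSubgroup) := by
    rw [h1]
    exact compactSpace_quotient_comap _ (continuous_expInfty E) (isOpenMap_expInfty E) _
  exact h2

end Preimage

/-! ### Galois cohomology of `K ⊗ Ω` -/

section Galois

open FunctionField Filter Topology

variable {k K Ω : Type*} [Field k] [Field K] [Algebra (RatFunc k) K]
  [Field Ω] [Algebra (RatFunc k) Ω] [Algebra (LocalInfty k) Ω]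
  [IsScalarTower (RatFunc k) (LocalInfty k) Ω]

lemma smul_toSep (g : Gal(Ω/LocalInfty k)) (y : KInfty k K) :
    g • toSep k K Ω y = toSep k K Ω y := by
  refine TensorProduct.induction_on (motive := fun y : LocalInfty k ⊗[RatFunc k] K =>
    g • toSep k K Ω y = toSep k K Ω y) y ?_ (fun c a => ?_) fun a b ha hb => ?_
  · exact (congrArg _ (map_zero (toSep k K Ω))).trans
      ((smul_zero g).trans (map_zero (toSep k K Ω)).symm)
  · change (g (algebraMap (LocalInfty k) Ω c)) ⊗ₜ[RatFunc k] a = _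
    rw [AlgEquiv.commutes]
    rfl
  · have h := map_add (toSep k K Ω) a b
    exact (congrArg _ h).trans ((smul_add g _ _).trans ((congrArg₂ _ ha hb).trans h.symm))

variable (k K) in
/-- The inclusion `Ω → K ⊗ Ω`. -/
def inclSep : Ω →ₐ[LocalInfty k] Ext k K Ω :=
  (Algebra.TensorProduct.includeLeft : Ω →ₐ[LocalInfty k] Ω ⊗[RatFunc k] K)

lemma smul_inclSep (g : Gal(Ω/LocalInfty k)) (a : Ω) :
    g • inclSep k K a = inclSep k K (g a) := by
  change (g a) ⊗ₜ[RatFunc k] (1 : K) = _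
  rfl

/-- The Galois action on `K ⊗ Ω` is continuous for the discrete topology. -/
lemma stabilizer_mem_nhds_one [Algebra.IsAlgebraic (LocalInfty k) Ω] (x : Ext k K Ω) :
    {g : Gal(Ω/LocalInfty k) | g • x = x} ∈ 𝓝 1 := by
  refine TensorProduct.induction_on (motive := fun x : Ω ⊗[RatFunc k] K =>
    {g : Gal(Ω/LocalInfty k) | g • (x : Ext k K Ω) = x} ∈ 𝓝 1) x ?_ (fun c a => ?_)
    fun a b ha hb => ?_
  · exact univ_mem' fun g => smul_zero g
  · refine (krullTopology_mem_nhds_one_iff _ _ _).mpr ⟨IntermediateField.adjoin (LocalInfty k) {c},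
      IntermediateField.adjoin.finiteDimensional (Algebra.IsIntegral.isIntegral c), fun g hg => ?_⟩
    have h : g c = c := (IntermediateField.mem_fixingSubgroup_iff _ _).mp hg c
      (IntermediateField.mem_adjoin_simple_self _ c)
    change (g c) ⊗ₜ[RatFunc k] a = c ⊗ₜ[RatFunc k] a
    rw [h]
  · filter_upwards [ha, hb] with g hga hgb
    exact (smul_add g _ _).trans (congrArg₂ _ hga hgb)

lemma isLocallyConstant_smul_sub [Algebra.IsAlgebraic (LocalInfty k) Ω] (x : Ext k K Ω) :
    IsLocallyConstant fun g : Gal(Ω/LocalInfty k) => g • x - x := by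
  refine (IsLocallyConstant.iff_eventually_eq _).mpr fun g => ?_
  have h1 : Tendsto (fun h => g⁻¹ * h) (𝓝 g) (𝓝 1) := by
    have := (continuous_const_mul g⁻¹).tendsto g
    rwa [inv_mul_cancel] at this
  filter_upwards [h1.eventually (stabilizer_mem_nhds_one x)] with h hh
  replace hh : (g⁻¹ * h) • x = x := hh
  have : h • x = g • x := by
    nth_rw 2 [← hh]
    rw [smul_smul, mul_inv_cancel_left]
  rw [this]

/-- The additive form of Hilbert's theorem 90 for `K ⊗ Ω`: if `f` factors through the Galois group
of the finite extension `L` and `a ∈ L` has trace `1`, then `f` is the coboundary of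
`-∑ f(σ) σ(a)`. -/
theorem exists_eq_smul_sub [IsGalois (LocalInfty k) Ω] {f : Gal(Ω/LocalInfty k) → Ext k K Ω}
    (hf : IsLocallyConstant f) (hmul : ∀ g h, f (g * h) = f g + g • f h) :
    ∃ x, ∀ g, f g = g • x - x := by
  have hone : f 1 = 0 := by simpa using hmul 1 1
  have hmem : {g | f g = 0} ∈ 𝓝 (1 : Gal(Ω/LocalInfty k)) := by
    filter_upwards [(IsLocallyConstant.iff_eventually_eq f).mp hf 1] with g hg
    exact hg.trans hone
  obtain ⟨L, hL, hLn, hLf⟩ := (krullTopology_mem_nhds_one_iff_of_normal _ _ _).mp hmem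
  have : IsGalois (LocalInfty k) L := ⟨⟩
  obtain ⟨a, ha⟩ := Algebra.trace_surjective (LocalInfty k) L 1
  have htr : ∑ σ : Gal(L/LocalInfty k), inclSep k K (σ a : Ω) = 1 := by
    have h1 := congrArg (fun x : L => inclSep k K (x : Ω))
      (trace_eq_sum_automorphisms (K := LocalInfty k) a)
    simp only [ha, map_one] at h1
    rw [← map_sum, ← map_one (inclSep k K)]
    refine Eq.trans ?_ h1.symm
    congr 1
    exact (map_sum L.val _ _).symm
  let res : Gal(Ω/LocalInfty k) →* Gal(L/LocalInfty k) := AlgEquiv.restrictNormalHom L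
  have hres : ∀ g (b : L), ((res g b : L) : Ω) = g b := fun g b =>
    AlgEquiv.restrictNormal_commutes g L b
  choose s hs using AlgEquiv.restrictNormalHom_surjective (F := LocalInfty k) (K₁ := L) Ω
  have hfac : ∀ g h, res g = res h → f g = f h := by
    intro g h hgh
    have h1 : f (g⁻¹ * h) = 0 := by
      refine hLf ((IntermediateField.mem_fixingSubgroup_iff _ _).mpr fun b hb => ?_)
      have h2 : res (g⁻¹ * h) = 1 := by rw [map_mul, map_inv, hgh, inv_mul_cancel]
      rw [← hres _ ⟨b, hb⟩, h2]
      rfl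
    rw [← mul_inv_cancel_left g h, hmul, h1, smul_zero, add_zero]
  refine ⟨-∑ σ, f (s σ) * inclSep k K (σ a : Ω), fun g => ?_⟩
  have key : g • ∑ σ, f (s σ) * inclSep k K (σ a : Ω) =
      ∑ σ, f (s σ) * inclSep k K (σ a : Ω) - f g := by
    rw [Finset.smul_sum, ← Equiv.sum_comp (Equiv.mulLeft (res g))
      (fun σ => f (s σ) * inclSep k K (σ a : Ω))]
    nth_rw 1 [← mul_one (f g)]
    rw [← htr, ← Equiv.sum_comp (Equiv.mulLeft (res g)) (fun σ => inclSep k K ((σ a : L) : Ω)),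
      Finset.mul_sum, ← Finset.sum_sub_distrib]
    refine Finset.sum_congr rfl fun σ _ => ?_
    have h1 : f (s (res g * σ)) = f g + g • f (s σ) := by
      rw [← hmul]
      refine hfac _ _ ?_
      rw [map_mul]
      exact (hs _).trans (congrArg _ (hs _).symm)
    rw [smul_mul', smul_inclSep, Equiv.coe_mulLeft, h1, AlgEquiv.mul_apply, hres]
    ring
  rw [smul_neg, key]
  abel

/-- The Galois invariants of `K ⊗ Ω` are `K_∞`. -/
theorem exists_toSep_eq [FiniteDimensional (RatFunc k) K] [IsGalois (LocalInfty k) Ω]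
    (y : Ext k K Ω) (hy : ∀ g : Gal(Ω/LocalInfty k), g • y = y) :
    ∃ z, toSep k K Ω z = y := by
  let b := Module.finBasis (RatFunc k) K
  let bΩ : Module.Basis _ Ω (Ω ⊗[RatFunc k] K) := Algebra.TensorProduct.basis Ω b
  let c := bΩ.equivFun y
  have hsum : ∀ d : Fin (Module.finrank (RatFunc k) K) → Ω,
      bΩ.equivFun.symm d = ∑ i, d i ⊗ₜ[RatFunc k] b i := fun d => by
    rw [Module.Basis.equivFun_symm_apply]
    refine Finset.sum_congr rfl fun i _ => ?_
    rw [Algebra.TensorProduct.basis_apply, TensorProduct.smul_tmul', smul_eq_mul, mul_one]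
  have hyc : (y : Ω ⊗[RatFunc k] K) = ∑ i, c i ⊗ₜ[RatFunc k] b i := by
    rw [← hsum]
    exact (bΩ.equivFun.symm_apply_apply y).symm
  have hc : ∀ i, c i ∈ Set.range (algebraMap (LocalInfty k) Ω) := by
    intro i
    refine (InfiniteGalois.mem_range_algebraMap_iff_fixed (c i)).mpr fun g => ?_
    have h1 : g • y = (∑ i, (g (c i)) ⊗ₜ[RatFunc k] b i : Ω ⊗[RatFunc k] K) := by
      have h2 : g • y = galMap k K Ω g (∑ i, c i ⊗ₜ[RatFunc k] b i : Ω ⊗[RatFunc k] K) := by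
        rw [← hyc]
        rfl
      rw [h2]
      exact map_sum (galMap k K Ω g) _ _
    rw [hy g, hyc, ← hsum, ← hsum] at h1
    exact (congrFun (bΩ.equivFun.symm.injective h1) i).symm
  choose d hd using hc
  refine ⟨(∑ i, d i ⊗ₜ[RatFunc k] b i : LocalInfty k ⊗[RatFunc k] K), ?_⟩
  refine (map_sum (toSep k K Ω) _ _).trans (Eq.trans ?_ hyc.symm)
  refine Finset.sum_congr rfl fun i _ => ?_
  rw [← hd]
  rfl

end Galois

/-! ### The connecting homomorphism -/

section Connecting

/-- A shortcut for instance search. -/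
local instance (A G M : Type*) [CommRing A] [Group G] [TopologicalSpace G] [AddCommGroup M] [Module A M]
    [DistribMulAction G M] [SMulCommClass G A M] : AddCommGroup (Z1 A G M) :=
  Submodule.addCommGroup _

/-- A shortcut for instance search. -/
local instance (A G M : Type*) [CommRing A] [Group G] [TopologicalSpace G] [AddCommGroup M] [Module A M]
    [DistribMulAction G M] [SMulCommClass G A M] : Module A (Z1 A G M) :=
  Submodule.module _

open FunctionField Filter Topology

variable {k K Ω : Type*} [Field k] [Finite k] [Field K] [Algebra k[X] K] [Algebra (RatFunc k) K]
  [IsScalarTower k[X] (RatFunc k) K] [FiniteDimensional (RatFunc k) K]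
  [Field Ω] [Algebra (RatFunc k) Ω] [Algebra (LocalInfty k) Ω]
  [IsScalarTower (RatFunc k) (LocalInfty k) Ω]
  (E : DrinfeldModule k (ringOfIntegers k K))

lemma expEq_sub {E : DrinfeldModule k (ringOfIntegers k K)} {x x' : Ext k K Ω}
    {y y' : E.Points (Ext k K Ω)} (h : E.ExpEq K x y) (h' : E.ExpEq K x' y') :
    E.ExpEq K (x - x') (y - y') := by
  have h1 : ∀ i, (x - x') ^ Nat.card k ^ i = x ^ Nat.card k ^ i - x' ^ Nat.card k ^ i := fun i => by
    rw [eq_sub_iff_add_eq, ← add_pow_card_pow k, sub_add_cancel]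
  have := HasSum.sub h h'
  simp only [DrinfeldModule.ExpEq, map_sub, h1, mul_sub]
  exact this

/-- The natural map `K_∞ → K ⊗ Ω`, as a homomorphism of `k((t⁻¹))`-algebras. -/
def toSepₐ : KInfty k K →ₐ[LocalInfty k] Ext k K Ω :=
  { toSep k K Ω with
    commutes' := fun c => by
      change (algebraMap (LocalInfty k) Ω c) ⊗ₜ[RatFunc k] (1 : K) =
        (algebraMap (LocalInfty k) Ω c) ⊗ₜ[RatFunc k] (1 : K)
      rfl }

lemma toSep_algebraMap (a : K) :
    toSep k K Ω (algebraMap K (KInfty k K) a) = algebraMap K (Ext k K Ω) a := by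
  change (algebraMap (LocalInfty k) Ω 1) ⊗ₜ[RatFunc k] a = (1 : Ω) ⊗ₜ[RatFunc k] a
  rw [map_one]

lemma toSep_phi (p : k[X]) (y : KInfty k K) :
    toSep k K Ω (E.phi (KInfty k K) p y) = E.phi (Ext k K Ω) p (toSep k K Ω y) := by
  have hbase : ∀ (c : ringOfIntegers k K),
      toSep k K Ω (algebraMap (ringOfIntegers k K) (KInfty k K) c) =
        algebraMap (ringOfIntegers k K) (Ext k K Ω) c := fun c => toSep_algebraMap (c : K)
  induction p using Polynomial.induction_on generalizing y with
  | C a =>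
    rw [DrinfeldModule.phi_C, DrinfeldModule.phi_C, Algebra.smul_def, Algebra.smul_def, map_mul,
      IsScalarTower.algebraMap_apply k[X] K (KInfty k K), toSep_algebraMap,
      ← IsScalarTower.algebraMap_apply]
  | add p q hp hq =>
    rw [map_add, map_add]
    exact (map_add (toSep k K Ω) _ _).trans (congrArg₂ _ (hp y) (hq y))
  | monomial n a h =>
    rw [pow_succ, ← mul_assoc, map_mul (E.phi (KInfty k K)), map_mul (E.phi (Ext k K Ω))]
    refine (h _).trans (congrArg _ ?_)
    refine (congrArg _ (E.phi_X y)).trans (Eq.trans ?_ (E.phi_X _).symm)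
    simp only [DrinfeldModule.phiT_apply, map_sum, map_mul, map_pow, hbase]

lemma expEq_toSep {E : DrinfeldModule k (ringOfIntegers k K)} {x y : KInfty k K}
    (h : E.ExpEq K x (E.toPoints _ y)) :
    E.ExpEq K (toSep k K Ω x) (E.toPoints _ (toSep k K Ω y)) := by
  have h1 := HasSum.map (show HasSum _ y from h) (toSepₐ (Ω := Ω))
    (IsModuleTopology.continuous_of_linearMap (toSepₐ (k := k) (K := K) (Ω := Ω)).toLinearMap)
  have h2 : (fun i => algebraMap K (Ext k K Ω) (E.expCoeff K i) *
      toSep k K Ω x ^ Nat.card k ^ i) = toSepₐ ∘ fun i =>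
        algebraMap K (KInfty k K) (E.expCoeff K i) * x ^ Nat.card k ^ i := funext fun i => by
    change _ = toSep k K Ω _
    rw [map_mul, map_pow, toSep_algebraMap]
  rw [DrinfeldModule.ExpEq, h2]
  exact h1

variable {E} in
lemma smul_sub_mem_periods {x : Ext k K Ω} {y : KInfty k K}
    (h : E.ExpEq K x (E.toPoints _ (toSep k K Ω y))) (g : Gal(Ω/LocalInfty k)) :
    g • x - x ∈ E.periods Ω := by
  have h1 := expEq_sub (h.gal g) h
  rwa [AddEquiv.symm_apply_apply, smul_toSep, sub_self] at h1

variable [IsSepClosure (LocalInfty k) Ω]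

variable {E} in
/-- The cocycle `g ↦ g x - x`, for `x` with `exp x ∈ E(K_∞)`. -/
def cocycle {x : Ext k K Ω} {y : KInfty k K} (h : E.ExpEq K x (E.toPoints _ (toSep k K Ω y))) :
    Z1 k[X] Gal(Ω/LocalInfty k) (E.periods Ω) :=
  ⟨fun g => ⟨g • x - x, smul_sub_mem_periods h g⟩, by
    have := isAlgebraic_of_isSepClosure (k := k) (Ω := Ω)
    refine (IsLocallyConstant.iff_eventually_eq _).mpr fun g => ?_
    filter_upwards [(IsLocallyConstant.iff_eventually_eq _).mp (isLocallyConstant_smul_sub x) g]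
      with g' hg'
    exact Subtype.ext hg', fun g g' => Subtype.ext (by
      change (g * g') • x - x = (g • x - x) + g • (g' • x - x)
      rw [mul_smul, smul_sub]
      abel)⟩

variable {E} in
/-- The class of the cocycle of `x` depends on `exp x` only. -/
lemma mkQ_cocycle_eq {x x' : Ext k K Ω} {y : KInfty k K}
    (h : E.ExpEq K x (E.toPoints _ (toSep k K Ω y)))
    (h' : E.ExpEq K x' (E.toPoints _ (toSep k K Ω y))) :
    (B1 k[X] Gal(Ω/LocalInfty k) (E.periods Ω)).mkQ (cocycle h) =
      (B1 k[X] Gal(Ω/LocalInfty k) (E.periods Ω)).mkQ (cocycle h') := by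
  refine (Submodule.Quotient.eq _).mpr ⟨⟨x - x', ?_⟩, fun g => Subtype.ext ?_⟩
  · have := expEq_sub h h'
    rwa [sub_self] at this
  · change (g • x - x) - (g • x' - x') = g • (x - x') - (x - x')
    rw [smul_sub]
    abel

/-- A point `x` of `K ⊗ Ω` with `exp x = y`, for `y ∈ E(K_∞)`. -/
lemma exists_expEq_toSep (y : KInfty k K) :
    ∃ x : Ext k K Ω, E.ExpEq K x (E.toPoints _ (toSep k K Ω y)) :=
  exists_expEq E _

variable (Ω) in
/-- The connecting homomorphism `δ : E(K_∞) → H¹(G, Λ_E)`. -/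
def connecting : E.Points (KInfty k K) →ₗ[k[X]] E.H1Periods Ω where
  toFun y := (B1 k[X] Gal(Ω/LocalInfty k) (E.periods Ω)).mkQ
    (cocycle (exists_expEq_toSep E ((E.toPoints _).symm y)).choose_spec)
  map_add' y y' := by
    have h := (exists_expEq_toSep (Ω := Ω) E ((E.toPoints _).symm y)).choose_spec
    have h' := (exists_expEq_toSep (Ω := Ω) E ((E.toPoints _).symm y')).choose_spec
    have h2 := h.add h'
    rw [← map_add, ← map_add, ← map_add] at h2
    rw [← map_add, mkQ_cocycle_eq _ h2]
    refine congrArg _ (Subtype.ext (funext fun g => Subtype.ext ?_))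
    change g • (_ + _) - (_ + _) = (g • _ - _) + (g • _ - _)
    rw [smul_add]
    abel
  map_smul' p y := by
    obtain ⟨y, rfl⟩ := (E.toPoints _).surjective y
    have h := (exists_expEq_toSep (Ω := Ω) E ((E.toPoints _).symm (E.toPoints _ y))).choose_spec
    have h2 := h.smul p
    rw [DrinfeldModule.smul_toPoints, ← toSep_phi] at h2
    refine (mkQ_cocycle_eq _ h2).trans (Eq.trans (congrArg _ ?_) (map_smul _ p _))
    refine Subtype.ext (funext fun g => Subtype.ext ?_)
    change g • (p • _) - p • _ = p • (g • _ - _)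
    rw [smul_sub, smul_comm]

lemma connecting_apply {x : Ext k K Ω} {y : KInfty k K}
    (h : E.ExpEq K x (E.toPoints _ (toSep k K Ω y))) :
    connecting Ω E (E.toPoints _ y) =
      (B1 k[X] Gal(Ω/LocalInfty k) (E.periods Ω)).mkQ (cocycle h) :=
  mkQ_cocycle_eq _ h

lemma isConnecting_connecting : E.IsConnecting Ω (connecting Ω E) := fun y =>
  ⟨exists_expEq_toSep E y, fun _ h => ⟨cocycle h, fun _ => rfl, connecting_apply E h⟩⟩

/-- `δ` is surjective because `H¹(G, K ⊗ Ω) = 0`. -/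
lemma connecting_surjective : Function.Surjective (connecting Ω E) := by
  have : IsGalois (LocalInfty k) Ω := IsSepClosure.isGalois
  intro c
  obtain ⟨f, rfl⟩ := Submodule.mkQ_surjective _ c
  obtain ⟨x, hx⟩ := exists_eq_smul_sub (f := fun g => (f.1 g : Ext k K Ω))
    (f.2.1.comp Subtype.val) fun g h => congrArg Subtype.val (f.2.2 g h)
  obtain ⟨z, hz, huniq⟩ := existsUnique_expEq E x
  obtain ⟨z, rfl⟩ := (E.toPoints _).surjective z
  have hinv : ∀ g : Gal(Ω/LocalInfty k), g • z = z := by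
    intro g
    have h1 := hz.gal g
    have h2 : g • x = x + f.1 g := by rw [hx g]; abel
    have h3 := hz.add (f.1 g).2
    rw [h2] at h1
    rw [add_zero] at h3
    have := (existsUnique_expEq E _).unique h1 h3
    rw [AddEquiv.symm_apply_apply] at this
    exact (E.toPoints _).injective this
  obtain ⟨y, rfl⟩ := exists_toSep_eq z hinv
  refine ⟨E.toPoints _ y, (connecting_apply E hz).trans (congrArg _ ?_)⟩
  exact Subtype.ext (funext fun g => Subtype.ext (hx g).symm)

lemma connecting_expInfty (x : KInfty k K) :
    connecting Ω E (E.toPoints _ (expInfty E x)) = 0 := by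
  rw [connecting_apply E (expEq_toSep (expEq_expInfty E x))]
  have h0 : cocycle (expEq_toSep (Ω := Ω) (expEq_expInfty E x)) = 0 :=
    Subtype.ext (funext fun g => Subtype.ext (by
      change g • toSep k K Ω x - toSep k K Ω x = 0
      rw [smul_toSep, sub_self]))
  rw [h0, map_zero]

/-- The cokernel is a quotient of the compact group `K_∞ / R` by an open subgroup, namely by a
subgroup containing the image of the exponential. -/
theorem finite_cokernel :
    Finite (E.H1Periods Ω ⧸ LinearMap.range (connecting Ω E ∘ₗ E.fromBase (KInfty k K))) := by
  let N := LinearMap.range (connecting Ω E ∘ₗ E.fromBase (KInfty k K))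
  let ρ : KInfty k K →+ E.H1Periods Ω ⧸ N :=
    (N.mkQ ∘ₗ connecting Ω E).toAddMonoidHom.comp (E.toPoints _).toAddMonoidHom
  have hρ : Function.Surjective ρ := (N.mkQ_surjective.comp (connecting_surjective E)).comp
    (E.toPoints _).surjective
  have hopen : IsOpen (ρ.ker : Set (KInfty k K)) := by
    refine AddSubgroup.isOpen_mono (H₁ := (expInfty E).range) ?_ (isOpenMap_expInfty E).isOpen_range
    rintro _ ⟨x, rfl⟩
    change N.mkQ (connecting Ω E (E.toPoints _ (expInfty E x))) = 0
    rw [connecting_expInfty, map_zero]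
  have hR : integersInfty k K ≤ ρ.ker := by
    rintro _ ⟨r, rfl⟩
    exact (Submodule.Quotient.mk_eq_zero N).mpr ⟨E.toPoints _ r, rfl⟩
  have hdisc : DiscreteTopology (KInfty k K ⧸ ρ.ker) := QuotientAddGroup.discreteTopology hopen
  have hcomp : CompactSpace (KInfty k K ⧸ ρ.ker) := by
    let ψ : KInfty k K ⧸ integersInfty k K →+ KInfty k K ⧸ ρ.ker :=
      QuotientAddGroup.map _ _ (AddMonoidHom.id _) hR
    have hψ : Continuous ψ := by
      rw [QuotientAddGroup.isOpenQuotientMap_mk.isQuotientMap.continuous_iff]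
      exact QuotientAddGroup.continuous_mk
    refine Function.Surjective.compactSpace (f := ψ) hψ fun a => ?_
    obtain ⟨a, rfl⟩ := QuotientAddGroup.mk_surjective a
    exact ⟨a, rfl⟩
  have : Finite (KInfty k K ⧸ ρ.ker) := finite_of_compact_of_discrete
  refine Finite.of_surjective (QuotientAddGroup.kerLift ρ) fun c => ?_
  obtain ⟨y, rfl⟩ := hρ c
  exact ⟨y, rfl⟩

end Connecting

end DrinfeldUnits

end

open scoped Polynomial in
open DrinfeldUnits in
theorem theorem1 {k K Ω : Type*} [Field k] [Finite k]
    -- `K` is a finite extension of `k(t)`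
    [Field K] [Algebra k[X] K] [Algebra (RatFunc k) K] [IsScalarTower k[X] (RatFunc k) K]
    [FiniteDimensional (RatFunc k) K]
    -- `Ω` is a separable closure of `k((t⁻¹))`
    [Field Ω] [Algebra (LocalInfty k) Ω] [IsSepClosure (LocalInfty k) Ω]
    [Algebra (RatFunc k) Ω] [IsScalarTower (RatFunc k) (LocalInfty k) Ω]
    (E : DrinfeldModule k (FunctionField.ringOfIntegers k K)) :
    -- the exponential converges everywhere, and is surjective on `K ⊗ Ω`
    (∀ x : KInfty k K, ∃! y : E.Points (KInfty k K), E.ExpEq K x y) ∧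
    (∀ x : Ext k K Ω, ∃! y : E.Points (Ext k K Ω), E.ExpEq K x y) ∧
    (∀ y : E.Points (Ext k K Ω), ∃ x : Ext k K Ω, E.ExpEq K x y) ∧
    -- the cokernel of `E(R) → E(K_∞) → H¹(G, Λ_E)` is finite
    (∃ δ : E.Points (KInfty k K) →ₗ[k[X]] E.H1Periods Ω, E.IsConnecting Ω δ ∧
      Finite (E.H1Periods Ω ⧸ LinearMap.range (δ ∘ₗ E.fromBase (KInfty k K)))) ∧
    -- `exp_E⁻¹(E(R))` is discrete and co-compact in `Lie_E(K_∞)`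
    DiscreteTopology E.expPreimage ∧
    CompactSpace (KInfty k K ⧸ E.expPreimage) := by
  have := isAlgebraic_of_isSepClosure (k := k) (Ω := Ω)
  exact ⟨existsUnique_expEq E, existsUnique_expEq E, exists_expEq E,
    ⟨connecting Ω E, isConnecting_connecting E, finite_cokernel E⟩,
    discreteTopology_expPreimage E, compactSpace_quotient_expPreimage E⟩
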